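/- **Theorem (Quantum Determinant Sampling).** There are an absolute constant $C>0$, a fixed classical program $P$ for a real RAM (unit cost for each index operation, array access, comparison, loop round and real operation $+,-,\times,/,\sqrt{\cdot},\arccos$), and for every $n$ a circuit layout $L_n$ on $n$ qubits, that is, layers of one- and two-qubit gates $X$, $CX$, $CZ$ and $RBS(\theta)$, acting on pairwise disjoint qubits within a layer, in which the angles $\theta$ are left as parameters, such that the following holds for all $n\ge 2$, $d\ge 1$ and every $A\in\mathbb{R}^{n\times d}$ of rank $d$. 1. On input $(n,d,A)$ the program $P$ stops after at most $C\,nd^2$ steps. It outputs a matrix $Q\in\mathbb{R}^{n\times d}$ with $Q^TQ=I_d$ and $\mathrm{Col}(Q)=\mathrm{Col}(A)$, and for each column $q^j$ of $Q$ the angles of the gates of $L_n$. 2. For each $j$, the layout $L_n$ with the angles for $q^j$ is a circuit that implements a Clifford loader $\mathcal{C}(q^j)$. 3. The composition $\mathcal{C}(q^d)\cdots\mathcal{C}(q^1)$ of these circuits has at most $C\,nd\log n$ gates and depth (number of layers) at most $C\,d\log n$. 4. If this circuit is applied to $|0^n\rangle$ and all qubits are measured in the standard basis, the set $S\subseteq[n]$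 of positions of ones in the outcome is distributed as $\Pr[S]=\det(A_S)^2/\det(A^TA)$ for $|S|=d$, and $\Pr[S]=0$ for $|S|\ne d$, where $A_S$ is the submatrix of $A$ with the rows in $S$. So each sample costs one run of the circuit, and the pre-processing is done only once. Here $RBS(\theta)$ is the two-qubit gate that fixes $|00\rangle$ and $|11\rangle$ and maps $|01\rangle\mapsto\cos\theta\,|01\rangle-\sin\theta\,|10\rangle$, $|10\rangle\mapsto\sin\theta\,|01\rangle+\cos\theta\,|10\rangle$, and $RBS_{ij}(\theta)$ is this gate on qubits $i\neq j$ (in this order). The operator $FBS_{ij}(\theta)$ acts on $|s\rangle$, $s\in\{0,1\}^n$, as $RBS_{ij}\big((-1)^{f}\theta\big)$, where $f$ is the number of ones of $s$ strictly between positions $i$ and $j$. A unary data loader for a unit vector $x\in\mathbb{R}^n$ is a circuit $D$ of $RBS$ gates with $D|e_1\rangle=\sum_i x_i|e_i\rangle$, where $e_i=0^{i-1}10^{n-i}$. A Clifford loader for $x$ is $\mathcal{C}(x)=D_F\,(X\otimes I^{\otimes(n-1)})\,D_F^{*}$, where $D_F$ is obtained from a unary data loader $D$ for $x$ by replacing each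 $RBS$ gate by the corresponding $FBS$ gate. -/

import Mathlib

open scoped Matrix

namespace QDS

/-! ## Quantum circuits on `n` qubits -/

/-- Bit strings of length `n`; they index the standard basis of the `n`-qubit Hilbert space. -/
abbrev Bits (n : ℕ) : Type := Fin n → Bool

/-- Operators on the `2 ^ n`-dimensional Hilbert space, written in the standard basis. -/
abbrev Op (n : ℕ) : Type := Matrix (Bits n) (Bits n) ℂ

/-- The standard basis vector `|b⟩`. -/
def ket {n : ℕ} (b : Bits n) : Bits n → ℂ := Pi.single b 1

/-- The bit string with ones exactly at the positions in `S`. -/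
def bitsOf {n : ℕ} (S : Finset (Fin n)) : Bits n := fun k => decide (k ∈ S)

/-- The one-qubit operator `M` acting on qubit `i`, and the identity on all other qubits. -/
def onQubit {n : ℕ} (i : Fin n) (M : Matrix Bool Bool ℂ) : Op n :=
  Matrix.of fun T S => if ∀ k, k ≠ i → T k = S k then M (T i) (S i) else 0

/-- The two-qubit operator `M` acting on the ordered pair of qubits `(i, j)`, and the identity on
all other qubits. -/
def onPair {n : ℕ} (i j : Fin n) (M : Matrix (Bool × Bool) (Bool × Bool) ℂ) : Op n :=
  Matrix.of fun T S =>
    if ∀ k, k ≠ i → k ≠ j → T k = S k then M (T i, T j) (S i, S j) else 0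

/-- The Pauli matrix `X`. -/
def xMatrix : Matrix Bool Bool ℂ := Matrix.of fun t s => if t = !s then 1 else 0

/-- The controlled-`X` gate; the first qubit is the control. -/
def cxMatrix : Matrix (Bool × Bool) (Bool × Bool) ℂ :=
  Matrix.of fun t s => if t = (s.1, xor s.1 s.2) then 1 else 0

/-- The controlled-`Z` gate. -/
def czMatrix : Matrix (Bool × Bool) (Bool × Bool) ℂ :=
  Matrix.diagonal fun s => if s = (true, true) then -1 else 1

/-- The reconfigurable beam splitter gate. -/
noncomputable def rbsMatrix (θ : ℝ) : Matrix (Bool × Bool) (Bool × Bool) ℂ :=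
  Matrix.of fun t s =>
    match t, s with
    | (false, false), (false, false) => 1
    | (false, true), (false, true) => (Real.cos θ : ℂ)
    | (false, true), (true, false) => (Real.sin θ : ℂ)
    | (true, false), (false, true) => -(Real.sin θ : ℂ)
    | (true, false), (true, false) => (Real.cos θ : ℂ)
    | (true, true), (true, true) => 1
    | _, _ => 0

/-- Elementary gates. The parameters of the beam splitters are taken from a type `α`: for `α = ℝ`
they are angles, and for `α = ℕ` they are names of parameters whose values are supplied later. -/
inductive Gate (n : ℕ) (α : Type) : Type where
  | x (i : Fin n)
  | cx (i j : Fin n) (h : i ≠ j)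
  | cz (i j : Fin n) (h : i ≠ j)
  | rbs (i j : Fin n) (h : i ≠ j) (θ : α)

/-- The qubits on which a gate acts. -/
def Gate.support {n : ℕ} {α : Type} : Gate n α → Finset (Fin n)
  | .x i => {i}
  | .cx i j _ => {i, j}
  | .cz i j _ => {i, j}
  | .rbs i j _ _ => {i, j}

/-- Substitute values for the parameters of a gate. -/
def Gate.map {n : ℕ} {α β : Type} (f : α → β) : Gate n α → Gate n β
  | .x i => .x i
  | .cx i j h => .cx i j h
  | .cz i j h => .cz i j h
  | .rbs i j h θ => .rbs i j h (f θ)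

/-- The unitary implemented by a gate. -/
noncomputable def Gate.op {n : ℕ} : Gate n ℝ → Op n
  | .x i => onQubit i xMatrix
  | .cx i j _ => onPair i j cxMatrix
  | .cz i j _ => onPair i j czMatrix
  | .rbs i j _ θ => onPair i j (rbsMatrix θ)

/-- The product of a sequence of operators, the head of the list being applied first. -/
noncomputable def seqOp {n : ℕ} : List (Op n) → Op n
  | [] => 1
  | U :: l => seqOp l * U

/-- A circuit is a sequence of layers, the head being applied first; a layer is a list of gates. -/
abbrev Circuit (n : ℕ) (α : Type) : Type := List (List (Gate n α))

namespace Circuit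

/-- The gates of each layer act on pairwise disjoint sets of qubits, so they can be applied in
parallel. -/
def IsParallel {n : ℕ} {α : Type} (c : Circuit n α) : Prop :=
  ∀ l ∈ c, l.Pairwise fun g g' => Disjoint g.support g'.support

/-- The total number of gates. -/
def size {n : ℕ} {α : Type} (c : Circuit n α) : ℕ := (List.flatten c).length

/-- The number of layers. -/
def depth {n : ℕ} {α : Type} (c : Circuit n α) : ℕ := List.length c

/-- Substitute values for the parameters of a circuit. -/
def fill {n : ℕ} {α β : Type} (c : Circuit n α) (f : α → β) : Circuit n β :=
  List.map (List.map (Gate.map f)) c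

/-- The unitary implemented by a circuit. -/
noncomputable def op {n : ℕ} (c : Circuit n ℝ) : Op n := seqOp ((List.flatten c).map Gate.op)

/-- The probability of the outcome `S` when the circuit is applied to `|0ⁿ⟩` and all qubits are
measured in the standard basis. -/
noncomputable def outcomeProb {n : ℕ} (c : Circuit n ℝ) (S : Finset (Fin n)) : ℝ :=
  ‖(op c *ᵥ ket (fun _ => false)) (bitsOf S)‖ ^ 2

end Circuit

/-! ## Unary data loaders and Clifford loaders -/

/-- The position and the angle of a beam splitter gate. -/
structure BeamSplitter (n : ℕ) : Type where
  fst : Fin n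
  snd : Fin n
  ne : fst ≠ snd
  angle : ℝ

/-- The gate `RBS_{ij}(θ)`. -/
noncomputable def BeamSplitter.rbs {n : ℕ} (b : BeamSplitter n) : Op n :=
  onPair b.fst b.snd (rbsMatrix b.angle)

/-- The number of ones of the bit string `S` at positions strictly between `i` and `j`. -/
def onesBetween {n : ℕ} (i j : Fin n) (S : Bits n) : ℕ :=
  (Finset.univ.filter fun k => min i j < k ∧ k < max i j ∧ S k = true).card

/-- The fermionic beam splitter `FBS_{ij}(θ)`: it acts on `|S⟩` as `RBS_{ij}(θ)` if `S` has an even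
number of ones between `i` and `j`, and as `RBS_{ij}(-θ)` otherwise. -/
noncomputable def BeamSplitter.fbs {n : ℕ} (b : BeamSplitter n) : Op n :=
  Matrix.of fun T S =>
    onPair b.fst b.snd (rbsMatrix ((-1) ^ onesBetween b.fst b.snd S * b.angle)) T S

/-- The unary amplitude encoding `∑ i, x i |e_i⟩`. -/
noncomputable def unary {n : ℕ} (x : Fin n → ℝ) : Bits n → ℂ :=
  ∑ i, (x i : ℂ) • ket (bitsOf {i})

/-- The circuit `D` of `RBS` gates maps `|e_1⟩` to the unary amplitude encoding of `x`. -/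
def IsUnaryDataLoader {n : ℕ} [NeZero n] (D : List (BeamSplitter n)) (x : Fin n → ℝ) : Prop :=
  seqOp (D.map BeamSplitter.rbs) *ᵥ ket (bitsOf {0}) = unary x

/-- The operator `D_F (X ⊗ I ⊗ ⋯ ⊗ I) D_F*`, where `D_F` arises from `D` by replacing each `RBS`
gate by the corresponding `FBS` gate. -/
noncomputable def cliffordLoader {n : ℕ} [NeZero n] (D : List (BeamSplitter n)) : Op n :=
  seqOp (D.map BeamSplitter.fbs) * onQubit 0 xMatrix * (seqOp (D.map BeamSplitter.fbs))ᴴ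

/-- The circuit `c` implements a Clifford loader for the vector `x`. -/
def ImplementsCliffordLoader {n : ℕ} [NeZero n] (c : Circuit n ℝ) (x : Fin n → ℝ) : Prop :=
  ∃ D : List (BeamSplitter n), IsUnaryDataLoader D x ∧ c.op = cliffordLoader D

/-! ## The determinant distribution -/

/-- `det (A_S)² / det (Aᵀ A)` for a set `S` of `d` rows, and `0` for all other sets of rows. -/
noncomputable def detDist {n d : ℕ} (A : Matrix (Fin n) (Fin d) ℝ) (S : Finset (Fin n)) : ℝ :=
  if h : S.card = d then (A.submatrix (S.orderEmbOfFin h) id).det ^ 2 / (Aᵀ * A).det else 0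

/-! ## Classical pre-processing: real random access machines with structured programs

A program is a fixed finite text. It handles natural numbers, which serve as loop bounds and array
indices, and real numbers, which are stored in two-dimensional arrays. -/

/-- Index registers and real arrays; `arr a i j` is the entry `(i, j)` of the array named `a`. -/
structure Mem : Type where
  reg : ℕ → ℕ
  arr : ℕ → ℕ → ℕ → ℝ

/-- Overwrite a register. -/
def Mem.setReg (m : Mem) (r v : ℕ) : Mem := { m with reg := Function.update m.reg r v }

/-- Overwrite an array entry. -/
noncomputable def Mem.setArr (m : Mem) (a i j : ℕ) (v : ℝ) : Mem :=
  { m with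
    arr := Function.update m.arr a (Function.update (m.arr a) i (Function.update (m.arr a i) j v)) }

/-- Expressions for natural numbers; subtraction is truncated. -/
inductive IExpr : Type where
  | lit (c : ℕ)
  | reg (r : ℕ)
  | add (e f : IExpr)
  | sub (e f : IExpr)

def IExpr.eval (m : Mem) : IExpr → ℕ
  | .lit c => c
  | .reg r => m.reg r
  | .add e f => e.eval m + f.eval m
  | .sub e f => e.eval m - f.eval m

/-- The number of steps that the evaluation takes. -/
def IExpr.time : IExpr → ℕ
  | .lit _ => 1
  | .reg _ => 1
  | .add e f => e.time + f.time + 1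
  | .sub e f => e.time + f.time + 1

/-- Expressions for real numbers. The operations have the total conventions `x / 0 = 0`,
`√x = 0` for `x < 0`, and `arccos x = arccos (max (-1) (min x 1))`. -/
inductive RExpr : Type where
  | lit (c : ℤ)
  | get (a : ℕ) (i j : IExpr)
  | add (e f : RExpr)
  | sub (e f : RExpr)
  | mul (e f : RExpr)
  | div (e f : RExpr)
  | sqrt (e : RExpr)
  | arccos (e : RExpr)

noncomputable def RExpr.eval (m : Mem) : RExpr → ℝ
  | .lit c => (c : ℝ)
  | .get a i j => m.arr a (i.eval m) (j.eval m)
  | .add e f => e.eval m + f.eval m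
  | .sub e f => e.eval m - f.eval m
  | .mul e f => e.eval m * f.eval m
  | .div e f => e.eval m / f.eval m
  | .sqrt e => Real.sqrt (e.eval m)
  | .arccos e => Real.arccos (e.eval m)

/-- The number of steps that the evaluation takes. -/
def RExpr.time : RExpr → ℕ
  | .lit _ => 1
  | .get _ i j => i.time + j.time + 1
  | .add e f => e.time + f.time + 1
  | .sub e f => e.time + f.time + 1
  | .mul e f => e.time + f.time + 1
  | .div e f => e.time + f.time + 1
  | .sqrt e => e.time + 1
  | .arccos e => e.time + 1

/-- Comparisons. -/
inductive Test : Type where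
  | ilt (e f : IExpr)
  | rlt (e f : RExpr)

def Test.holds (m : Mem) : Test → Prop
  | .ilt e f => e.eval m < f.eval m
  | .rlt e f => e.eval m < f.eval m

def Test.time : Test → ℕ
  | .ilt e f => e.time + f.time + 1
  | .rlt e f => e.time + f.time + 1

/-- Programs. `loop r e p` evaluates `e` once, to `k` say, and then runs `p` with register `r`
set to `0, 1, …, k - 1` in turn. -/
inductive Prog : Type where
  | setReg (r : ℕ) (e : IExpr)
  | setArr (a : ℕ) (i j : IExpr) (e : RExpr)
  | seq (p q : Prog)
  | ite (t : Test) (p q : Prog)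
  | loop (r : ℕ) (e : IExpr) (p : Prog)

/-- The memory after `k` rounds of a loop with counter `r` and body `f`. -/
def loopState (r : ℕ) (f : Mem → Mem) (m : Mem) : ℕ → Mem
  | 0 => m
  | k + 1 => f ((loopState r f m k).setReg r k)

open Classical in
/-- The memory after the execution of a program. -/
noncomputable def Prog.exec : Prog → Mem → Mem
  | .setReg r e, m => m.setReg r (e.eval m)
  | .setArr a i j e, m => m.setArr a (i.eval m) (j.eval m) (e.eval m)
  | .seq p q, m => q.exec (p.exec m)
  | .ite t p q, m => if t.holds m then p.exec m else q.exec m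
  | .loop r e p, m => loopState r p.exec m (e.eval m)

open Classical in
/-- The number of steps of the execution of a program. Every arithmetic operation, square root,
arccosine, comparison, memory access, assignment and loop round counts. -/
noncomputable def Prog.time : Prog → Mem → ℕ
  | .setReg _ e, _ => e.time + 1
  | .setArr _ i j e, _ => i.time + j.time + e.time + 1
  | .seq p q, m => p.time m + q.time (p.exec m)
  | .ite t p q, m => t.time + if t.holds m then p.time m else q.time m
  | .loop r e p, m =>
      e.time + 1 +
        ∑ k ∈ Finset.range (e.eval m), (p.time ((loopState r p.exec m k).setReg r k) + 1)

/-- The initial memory: `n` and `d` are in registers `0` and `1`, the matrix is in array `0`, and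
everything else is zero. -/
noncomputable def inputMem {n d : ℕ} (A : Matrix (Fin n) (Fin d) ℝ) : Mem where
  reg r := if r = 0 then n else if r = 1 then d else 0
  arr a i j := if h : a = 0 ∧ i < n ∧ j < d then A ⟨i, h.2.1⟩ ⟨j, h.2.2⟩ else 0

/-- The `n × d` matrix stored in array `1`. -/
def outputMatrix (n d : ℕ) (m : Mem) : Matrix (Fin n) (Fin d) ℝ :=
  Matrix.of fun i j => m.arr 1 i j

/-- The angles stored in row `j` of array `2`. -/
def outputAngles (m : Mem) (j : ℕ) : ℕ → ℝ := fun k => m.arr 2 j k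

end QDS

namespace QDS

/-! ## Jordan–Wigner operators and fermionic beam splitters -/

/-! Everything goes through one operator, Γ(x) = ∑ x_i Z_1⋯Z_{i-1} X_i, which is `jw` on all qubits.
Conjugation by a fermionic beam splitter rotates two coefficients of Γ, because the sign in FBS is
the Z-string between the two qubits (`jw_givens_mul_signedRbs`). An RBS gate performs the same
rotation on unary encodings. Since Γ(e_1) is X on the first qubit, a Clifford loader whose gates
rotate e_1 to x is Γ(x).

FBS is not an elementary gate. The circuit therefore reaches Γ(x) through the same operator on a
shrinking set A of active qubits. If l < r are neighbours in A, the string between them is empty and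
a plain RBS rotates their coefficients. Once the coefficient of r is 0, conjugation by CX with
control r and target l, which turns Z_l into Z_l Z_r, stores the parity of r in l, and r can leave A
(`jw_erase_mul_cx`). Pairing all neighbours at once halves A, so about log₂ n levels of four layers
each lead down to a single X (`loads_layers`). The predicate `Loads` carries along the list of beam
splitters that witnesses the Clifford loader.

For the amplitudes, let Γ(q) act on ∑ det(Q_S)|S⟩, where Q has k orthonormal columns orthogonal to
q. The terms that create a one form a Laplace expansion along the new column q; the terms that
remove a one add up to a combination of inner products of q with the columns of Q, hence to 0
(`jw_mulVec_detOn`). So the final state is ±∑ det(Q_S)|S⟩. Writing A = QR gives det(A_S) = det(Q_S)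
det R and det(AᵀA) = (det R)², which is the claimed distribution.

The program runs classical Gram–Schmidt, O(nd) steps per column, and then one bottom-up pass over a
binary heap with at most 2n leaves. The value of an inner node is, up to sign, the norm of the
leaves below it, and its angle splits this value between its children (`AnglesFor.heapEncodes`). -/

/-- The eigenvalue of the Pauli matrix `Z`. -/
def zsign (b : Bool) : ℂ := if b then -1 else 1

@[simp] lemma zsign_not (b : Bool) : zsign (!b) = -zsign b := by cases b <;> simp [zsign]

lemma zsign_mul_self (b : Bool) : zsign b * zsign b = 1 := by cases b <;> simp [zsign]

/-- Flip the bit at position `i`. -/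
def flip {n : ℕ} (T : Bits n) (i : Fin n) : Bits n := Function.update T i (!T i)

@[simp] lemma flip_self {n : ℕ} (T : Bits n) (i : Fin n) : flip T i i = !T i := by simp [flip]

lemma flip_ne {n : ℕ} (T : Bits n) {i j : Fin n} (h : j ≠ i) : flip T i j = T j := by
  simp [flip, h]

@[simp] lemma flip_flip {n : ℕ} (T : Bits n) (i : Fin n) : flip (flip T i) i = T := by
  simp [flip]

lemma flip_comm {n : ℕ} (T : Bits n) (i j : Fin n) : flip (flip T i) j = flip (flip T j) i := by
  by_cases h : i = j
  · rw [h]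
  · rw [flip, flip, flip, flip, Function.update_of_ne (Ne.symm h), Function.update_of_ne h,
      Function.update_comm h]

/-- The parity sign of the bits of `T` at the positions in `B`. -/
def psign {n : ℕ} (B : Finset (Fin n)) (T : Bits n) : ℂ := ∏ j ∈ B, zsign (T j)

lemma psign_flip {n : ℕ} (B : Finset (Fin n)) (T : Bits n) (i : Fin n) :
    psign B (flip T i) = if i ∈ B then -psign B T else psign B T := by
  have h : ∀ j ∈ B, zsign (flip T i j) = (if j = i then -1 else 1) * zsign (T j) := by
    intro j _
    by_cases hj : j = i
    · subst hj; simp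
    · simp [flip_ne T hj, hj]
  rw [psign, Finset.prod_congr rfl h, Finset.prod_mul_distrib, Finset.prod_ite_eq']
  split_ifs <;> simp [psign]

lemma psign_mul_self {n : ℕ} (B : Finset (Fin n)) (T : Bits n) : psign B T * psign B T = 1 := by
  rw [psign, ← Finset.prod_mul_distrib]
  exact Finset.prod_eq_one fun j _ => zsign_mul_self _

/-- The elements of `A` below `i`. -/
abbrev below {n : ℕ} (A : Finset (Fin n)) (i : Fin n) : Finset (Fin n) := A.filter (· < i)

/-- The elements of `A` strictly between `l` and `r`. -/
abbrev betw {n : ℕ} (A : Finset (Fin n)) (l r : Fin n) : Finset (Fin n) :=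
  A.filter fun k => l < k ∧ k < r

/-- The operator `∑ i ∈ A, w i • Z_{A, < i} X_i`, where `Z_{A, < i}` is the product of the Pauli
matrices `Z` at the positions of `A` below `i`. -/
noncomputable def jw {n : ℕ} (A : Finset (Fin n)) (w : Fin n → ℝ) : Op n :=
  Matrix.of fun T S => ∑ i ∈ A, if S = flip T i then (w i : ℂ) * psign (below A i) T else 0

lemma jw_mulVec {n : ℕ} (A : Finset (Fin n)) (w : Fin n → ℝ) (v : Bits n → ℂ) (T : Bits n) :
    (jw A w *ᵥ v) T = ∑ i ∈ A, (w i : ℂ) * psign (below A i) T * v (flip T i) := by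
  simp only [Matrix.mulVec, dotProduct, jw, Matrix.of_apply, Finset.sum_mul]
  rw [Finset.sum_comm]
  refine Finset.sum_congr rfl fun i _ => ?_
  simp [ite_mul]

/-- The beam splitter on the qubits `l` and `r`, with the sign of the angle given by the parity of
the ones at the positions in `B`. -/
noncomputable def signedRbs {n : ℕ} (B : Finset (Fin n)) (l r : Fin n) (θ : ℝ) : Op n :=
  Matrix.of fun T S =>
    (if S = T then (if T l = T r then 1 else (Real.cos θ : ℂ)) else 0) +
    (if S = flip (flip T l) r then
      (if T l = T r then 0 else zsign (T l) * psign B T * (Real.sin θ : ℂ)) else 0)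

lemma signedRbs_mulVec {n : ℕ} (B : Finset (Fin n)) (l r : Fin n) (θ : ℝ) (v : Bits n → ℂ)
    (T : Bits n) :
    (signedRbs B l r θ *ᵥ v) T = if T l = T r then v T else
      (Real.cos θ : ℂ) * v T +
        zsign (T l) * psign B T * (Real.sin θ : ℂ) * v (flip (flip T l) r) := by
  simp only [Matrix.mulVec, dotProduct, signedRbs, Matrix.of_apply, add_mul, ite_mul, zero_mul,
    Finset.sum_add_distrib, Finset.sum_ite_eq', Finset.mem_univ, if_true]
  split_ifs <;> simp

lemma bits_pair_cases {n : ℕ} {l r : Fin n} (T S : Bits n)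
    (h : ∀ k, k ≠ l → k ≠ r → T k = S k) (h1 : T l = S l) (h2 : T r = S r) : S = T := by
  funext k
  by_cases hl : k = l
  · subst hl; exact h1.symm
  by_cases hr : k = r
  · subst hr; exact h2.symm
  exact (h k hl hr).symm

lemma onPair_rbs_apply {n : ℕ} {l r : Fin n} (h : l ≠ r) (θ : ℝ) (T S : Bits n) :
    onPair l r (rbsMatrix θ) T S = signedRbs ∅ l r θ T S := by
  simp only [onPair, signedRbs, Matrix.of_apply]
  by_cases hk : ∀ k, k ≠ l → k ≠ r → T k = S k
  · rw [if_pos hk]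
    have e1 : S = T ↔ (T l = S l ∧ T r = S r) :=
      ⟨fun e => by simp [e], fun e => bits_pair_cases T S hk e.1 e.2⟩
    have e2 : S = flip (flip T l) r ↔ (S l = !T l ∧ S r = !T r) := by
      constructor
      · intro e
        subst e
        simp [flip_ne _ h, flip_ne _ h.symm]
      · intro e
        apply bits_pair_cases (l := l) (r := r)
        · intro k h1 h2
          rw [flip_ne _ h2, flip_ne _ h1, hk k h1 h2]
        · rw [flip_ne _ h, flip_self, e.1]
        · rw [flip_self, flip_ne _ h.symm, e.2]
    simp only [e1, e2]
    cases T l <;> cases T r <;> cases S l <;> cases S r <;> simp [rbsMatrix, zsign, psign]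
  · rw [if_neg hk, if_neg, if_neg]
    · simp
    · rintro rfl
      exact hk fun k h1 h2 => by rw [flip_ne _ h2, flip_ne _ h1]
    · rintro rfl
      exact hk fun k _ _ => rfl

lemma onPair_rbs {n : ℕ} {l r : Fin n} (h : l ≠ r) (θ : ℝ) :
    onPair l r (rbsMatrix θ) = signedRbs ∅ l r θ :=
  Matrix.ext fun T S => onPair_rbs_apply h θ T S

lemma signedRbs_swap {n : ℕ} {l r : Fin n} (B : Finset (Fin n)) (θ : ℝ) :
    signedRbs B r l θ = signedRbs B l r (-θ) := by
  ext T S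
  simp only [signedRbs, Matrix.of_apply, flip_comm T r l, eq_comm (a := T r), Real.cos_neg,
    Real.sin_neg]
  congr 2
  cases T l <;> cases T r <;> simp [zsign]

lemma signedRbs_mul_neg {n : ℕ} {B : Finset (Fin n)} {l r : Fin n} (h : l ≠ r) (hl : l ∉ B)
    (hr : r ∉ B) (θ : ℝ) : signedRbs B l r θ * signedRbs B l r (-θ) = 1 := by
  apply Matrix.ext_of_mulVec_single
  intro S
  rw [← Matrix.mulVec_mulVec, Matrix.one_mulVec]
  generalize (Pi.single S 1 : Bits n → ℂ) = v
  funext T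
  have hc : (Real.cos θ : ℂ) * Real.cos θ + (Real.sin θ : ℂ) * Real.sin θ = 1 := by
    exact_mod_cast (by nlinarith [Real.cos_sq_add_sin_sq θ] :
      Real.cos θ * Real.cos θ + Real.sin θ * Real.sin θ = 1)
  have e : flip (flip (flip (flip T l) r) l) r = T := by
    rw [flip_comm (flip T l) r l, flip_flip, flip_flip]
  simp only [signedRbs_mulVec, flip_self, flip_ne _ h, flip_ne _ h.symm, psign_flip, hl, hr,
    if_false, e, Real.cos_neg, Real.sin_neg, Complex.ofReal_neg]
  have hp := psign_mul_self B T
  generalize psign B T = p at hp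
  by_cases hT : T l = T r
  · simp [hT]
  · have hT' : ¬ ((!T l) = !T r) := by simpa using hT
    rw [if_neg hT, if_neg hT, if_neg hT']
    have hz := zsign_mul_self (T l)
    rw [zsign_not]
    generalize zsign (T l) = z at *
    linear_combination v T * hc + (Real.sin θ : ℂ) * Real.sin θ * v T * (p * p * hz + hp)

lemma signedRbs_conjTranspose {n : ℕ} {B : Finset (Fin n)} {l r : Fin n} (h : l ≠ r) (hl : l ∉ B)
    (hr : r ∉ B) (θ : ℝ) : (signedRbs B l r θ)ᴴ = signedRbs B l r (-θ) := by
  ext T S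
  have hz : ∀ b, star (zsign b) = zsign b := by intro b; cases b <;> simp [zsign]
  have hp : ∀ S, star (psign B S) = psign B S := by
    intro S
    simp only [psign, star_prod, hz]
  have e : T = flip (flip S l) r ↔ S = flip (flip T l) r := by
    constructor <;> rintro rfl <;> rw [flip_comm, flip_flip, flip_flip]
  simp only [Matrix.conjTranspose_apply, signedRbs, Matrix.of_apply, star_add, e, eq_comm (a := T),
    Real.cos_neg, Real.sin_neg]
  congr 1
  · by_cases hS : S = T
    · subst hS; split_ifs <;> simp only [star_one, star_zero, Complex.star_def, Complex.conj_ofReal]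
    · simp [hS]
  · by_cases hS : S = flip (flip T l) r
    · subst hS
      simp only [flip_self, flip_ne _ h, flip_ne _ h.symm, psign_flip, hl, hr, if_false, if_true]
      by_cases hT : T l = T r
      · simp [hT]
      · have hT' : ¬ ((!T l) = !T r) := by simpa using hT
        rw [if_neg hT, if_neg hT']
        rw [star_mul', star_mul', hz, hp, Complex.star_def, Complex.conj_ofReal, zsign_not]
        push_cast
        ring
    · simp [hS]

/-- The Givens rotation of the coordinates `l` and `r`. -/
noncomputable def givens {n : ℕ} (l r : Fin n) (θ : ℝ) (w : Fin n → ℝ) : Fin n → ℝ := fun i =>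
  if i = l then Real.cos θ * w l - Real.sin θ * w r
  else if i = r then Real.sin θ * w l + Real.cos θ * w r
  else w i

/-- The quotient of the two strings is Z_l times the string strictly between. This is the sign of
the off-diagonal entries of `signedRbs (betw A l r) l r`, which is why the strings cancel in the
rotation. -/
lemma psign_below_eq {n : ℕ} {A : Finset (Fin n)} {l r : Fin n} (h : l < r) (hl : l ∈ A)
    (T : Bits n) :
    psign (below A r) T = psign (below A l) T * zsign (T l) * psign (betw A l r) T := by
  have e : below A r = (insert l (below A l)) ∪ betw A l r := by
    ext k
    simp only [below, betw, Finset.mem_union, Finset.mem_insert, Finset.mem_filter]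
    constructor
    · rintro ⟨h1, h2⟩
      rcases lt_trichotomy k l with h3 | h3 | h3
      · exact Or.inl (Or.inr ⟨h1, h3⟩)
      · exact Or.inl (Or.inl h3)
      · exact Or.inr ⟨h1, h3, h2⟩
    · rintro ((h3 | ⟨h1, h2⟩) | ⟨h1, h2, h3⟩)
      · subst h3; exact ⟨hl, h⟩
      · exact ⟨h1, h2.trans h⟩
      · exact ⟨h1, h3⟩
  have hd : Disjoint (insert l (below A l)) (betw A l r) := by
    rw [Finset.disjoint_left]
    intro k h1 h2
    simp only [below, betw, Finset.mem_insert, Finset.mem_filter] at h1 h2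
    rcases h1 with h1 | h1
    · exact absurd h2.2.1 (by simp [h1])
    · exact absurd (h1.2.trans h2.2.1) (lt_irrefl _)
  have hni : l ∉ below A l := by simp [below]
  rw [e, psign, Finset.prod_union hd, Finset.prod_insert hni]
  simp only [psign]
  ring

/-- Beam splitters rotate the coefficients of a Jordan–Wigner operator. -/
lemma jw_givens_mul_signedRbs {n : ℕ} {A : Finset (Fin n)} {l r : Fin n} (h : l < r) (hl : l ∈ A)
    (hr : r ∈ A) (θ : ℝ) (w : Fin n → ℝ) :
    jw A (givens l r θ w) * signedRbs (betw A l r) l r θ =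
      signedRbs (betw A l r) l r θ * jw A w := by
  apply Matrix.ext_of_mulVec_single
  intro S
  rw [← Matrix.mulVec_mulVec, ← Matrix.mulVec_mulVec]
  generalize (Pi.single S 1 : Bits n → ℂ) = v
  funext T
  have hne := h.ne
  have hr' : r ∈ A.erase l := Finset.mem_erase.2 ⟨hne.symm, hr⟩
  rw [jw_mulVec, signedRbs_mulVec, jw_mulVec, jw_mulVec, ← Finset.add_sum_erase _ _ hl,
    ← Finset.add_sum_erase _ _ hr', ← Finset.add_sum_erase _ _ hl, ← Finset.add_sum_erase _ _ hr',
    ← Finset.add_sum_erase _ _ hl, ← Finset.add_sum_erase _ _ hr']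
  have hlb : l ∉ betw A l r := by simp [betw]
  have hrb : r ∉ betw A l r := by simp [betw]
  have hll : l ∉ below A l := by simp [below]
  have hrr : r ∉ below A r := by simp [below]
  have hrl : r ∉ below A l := by simp [below, h.le]
  have hlr : l ∈ below A r := by simp [below, h, hl]
  have e1 : flip (flip (flip T l) l) r = flip T r := by rw [flip_flip]
  have e2 : flip (flip (flip T r) l) r = flip T l := by rw [flip_comm T, flip_flip]
  have e3 : flip (flip (flip T l) r) l = flip T r := by rw [flip_comm, flip_flip]
  have e4 : flip (flip (flip T l) r) r = flip T l := by rw [flip_flip]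
  -- The summands at other positions commute with the beam splitter. Flipping both `l` and `r`
  -- changes the string below `i` only for `l < i < r`, and exactly then flipping `i` changes the
  -- sign of the beam splitter.
  have key : ∀ i ∈ (A.erase l).erase r,
      (givens l r θ w i : ℂ) * psign (below A i) T *
        (signedRbs (betw A l r) l r θ *ᵥ v) (flip T i) =
      if T l = T r then (w i : ℂ) * psign (below A i) T * v (flip T i) else
        (Real.cos θ : ℂ) * ((w i : ℂ) * psign (below A i) T * v (flip T i)) +
        zsign (T l) * psign (betw A l r) T * (Real.sin θ : ℂ) *
        ((w i : ℂ) * psign (below A i) (flip (flip T l) r) * v (flip (flip (flip T l) r) i)) := by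
    intro i hi
    rw [Finset.mem_erase, Finset.mem_erase] at hi
    obtain ⟨hir, hil, hiA⟩ := hi
    have e5 : flip (flip (flip T l) r) i = flip (flip (flip T i) l) r := by
      rw [flip_comm (flip T l) r i, flip_comm T l i]
    have hg : givens l r θ w i = w i := by simp [givens, hil, hir]
    rw [signedRbs_mulVec, flip_ne _ hil.symm, flip_ne _ hir.symm, hg]
    by_cases hT : T l = T r
    · rw [if_pos hT, if_pos hT]
    rw [if_neg hT, if_neg hT, e5, psign_flip, psign_flip, psign_flip]
    simp only [below, betw, Finset.mem_filter, hl, hr, hiA, true_and]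
    rcases lt_or_gt_of_ne hil with h1 | h1
    · rw [if_neg (by simp [h1.le]), if_neg (by simp [(h1.trans h).le]), if_neg (by simp [h1.le])]
      ring
    · rcases lt_or_gt_of_ne hir with h2 | h2
      · rw [if_pos ⟨h1, h2⟩, if_neg (by simp [h2.le]), if_pos h1]
        ring
      · rw [if_neg (by simp [h2.le]), if_pos h2, if_pos h1]
        ring
  rw [Finset.sum_congr rfl key]
  have gl : givens l r θ w l = Real.cos θ * w l - Real.sin θ * w r := by simp [givens]
  have gr : givens l r θ w r = Real.sin θ * w l + Real.cos θ * w r := by simp [givens, hne.symm]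
  rw [signedRbs_mulVec, signedRbs_mulVec, gl, gr]
  simp only [psign_flip, hlb, hrb, hll, hrl, if_false, e1, e2, e3, e4, flip_self,
    flip_ne _ hne, flip_ne _ hne.symm, psign_below_eq h hl]
  have hp := psign_mul_self (betw A l r) T
  generalize psign (betw A l r) T = p at *
  generalize psign (below A l) T = q at *
  -- A single flip of `l` or `r` exchanges equal and unequal bits. So for equal bits only the
  -- splitter on the left-hand side mixes the terms at `l` and `r`, and for unequal bits only the
  -- one on the right-hand side does.
  by_cases hT : T l = T r
  · have h1 : ¬ ((!T l) = T r) := by rw [hT]; simp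
    have h2 : ¬ (T l = !T r) := by rw [hT]; simp
    simp only [if_pos hT, if_neg h1, if_neg h2]
    have hc : (Real.cos θ : ℂ) * Real.cos θ + (Real.sin θ : ℂ) * Real.sin θ = 1 := by
      exact_mod_cast (by nlinarith [Real.cos_sq_add_sin_sq θ] :
        Real.cos θ * Real.cos θ + Real.sin θ * Real.sin θ = 1)
    have hz := zsign_mul_self (T l)
    rw [zsign_not]
    generalize zsign (T l) = z at *
    push_cast
    push_cast at hc
    linear_combination ((w l : ℂ) * q * v (flip T l) + z * p * w r * q * v (flip T r)) * hc +
      Complex.sin θ * (Complex.sin θ * w l + Complex.cos θ * w r) * q * v (flip T l) *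
        (p * p * hz + hp)
  · have h1 : (!T l) = T r := by revert hT; cases T l <;> cases T r <;> simp
    have h2 : T l = !T r := by rw [← h1]; simp
    simp only [if_neg hT, if_pos h1, if_pos h2]
    have hz := zsign_mul_self (T l)
    rw [Finset.sum_add_distrib, ← Finset.mul_sum, ← Finset.mul_sum, zsign_not]
    generalize zsign (T l) = z at *
    push_cast
    linear_combination Complex.sin θ * w r * q * v (flip T l) * (p * p * hz + hp)

/-! ### Removing qubits with CX gates, and the base operator X -/

lemma onPair_cx_mulVec {n : ℕ} {l r : Fin n} (h : r ≠ l) (v : Bits n → ℂ) (T : Bits n) :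
    (onPair r l cxMatrix *ᵥ v) T = v (if T r then flip T l else T) := by
  simp only [Matrix.mulVec, dotProduct]
  rw [Finset.sum_eq_single (if T r then flip T l else T)]
  · have hk : ∀ k, k ≠ r → k ≠ l → T k = (if T r then flip T l else T) k := by
      intro k _ h2
      split_ifs
      · rw [flip_ne _ h2]
      · rfl
    simp only [onPair, Matrix.of_apply]
    rw [if_pos hk]
    cases hr : T r <;> cases hl : T l <;> simp [cxMatrix, flip_ne _ h, hr, hl]
  · intro S _ hS
    simp only [onPair, Matrix.of_apply]
    by_cases hk : ∀ k, k ≠ r → k ≠ l → T k = S k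
    · rw [if_pos hk]
      have : ¬ (S r = T r ∧ S l = xor (T r) (T l)) := by
        rintro ⟨e1, e2⟩
        apply hS
        refine (bits_pair_cases (l := r) (r := l) _ _ ?_ ?_ ?_)
        · intro k h1 h2
          rw [← hk k h1 h2]
          split_ifs
          · rw [flip_ne _ h2]
          · rfl
        · rw [e1]
          split_ifs
          · rw [flip_ne _ h]
          · rfl
        · rw [e2]
          cases hr : T r <;> simp
      revert this
      cases T r <;> cases T l <;> cases S r <;> cases S l <;> simp [cxMatrix]
    · rw [if_neg hk, zero_mul]
  · simp

lemma onPair_cx_mul_self {n : ℕ} {l r : Fin n} (h : r ≠ l) :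
    onPair r l cxMatrix * onPair r l cxMatrix = 1 := by
  apply Matrix.ext_of_mulVec_single
  intro S
  rw [← Matrix.mulVec_mulVec, Matrix.one_mulVec]
  funext T
  rw [onPair_cx_mulVec h, onPair_cx_mulVec h]
  cases hr : T r <;> simp [hr, flip_ne _ h]

/-- A `CX` gate removes from a Jordan–Wigner operator a control qubit with coefficient zero. -/
lemma jw_erase_mul_cx {n : ℕ} {A : Finset (Fin n)} {l r : Fin n} (h : l < r) (hl : l ∈ A)
    (hr : r ∈ A) (hA : betw A l r = ∅) (w : Fin n → ℝ) (hw : w r = 0) :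
    jw (A.erase r) w * onPair r l cxMatrix = onPair r l cxMatrix * jw A w := by
  apply Matrix.ext_of_mulVec_single
  intro S
  rw [← Matrix.mulVec_mulVec, ← Matrix.mulVec_mulVec]
  generalize (Pi.single S 1 : Bits n → ℂ) = v
  funext T
  have hne := h.ne
  rw [onPair_cx_mulVec hne.symm, jw_mulVec, jw_mulVec, ← Finset.add_sum_erase _ _ hr, hw]
  simp only [Complex.ofReal_zero, zero_mul, zero_add]
  refine Finset.sum_congr rfl fun i hi => ?_
  rw [Finset.mem_erase] at hi
  rw [onPair_cx_mulVec hne.symm, flip_ne _ hi.1.symm]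
  have e1 : (if T r then flip (flip T i) l else flip T i) =
      flip (if T r then flip T l else T) i := by
    split_ifs
    · rw [flip_comm]
    · rfl
  rw [e1]
  congr 2
  -- Above `r` both `l` and `r` are in the string, and CX turns Z_l into Z_l Z_r. Otherwise `i ≤ l`,
  -- since no active position lies between, and the string contains neither.
  by_cases hri : r < i
  · have hrm : r ∈ below A i := by simp [below, hr, hri]
    have hlm : l ∈ below A i := by simp [below, hl, h.trans hri]
    have e2 : below (A.erase r) i = (below A i).erase r := by
      simp only [below, Finset.filter_erase]
    have e3 : ∀ T : Bits n, psign (below A i) T = zsign (T r) * psign ((below A i).erase r) T :=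
      fun T => (Finset.mul_prod_erase _ _ hrm).symm
    rw [e2, e3]
    have hlm' : l ∈ (below A i).erase r := Finset.mem_erase.2 ⟨hne, hlm⟩
    cases hT : T r
    · simp [hT, zsign]
    · simp [hT, zsign, flip_ne _ hne.symm, psign_flip, hlm, hne]
  · have hil : ¬ l < i := by
      intro hli
      have : i ∈ betw A l r := by
        simp only [betw, Finset.mem_filter]
        exact ⟨hi.2, hli, lt_of_le_of_ne (not_lt.1 hri) hi.1⟩
      rw [hA] at this
      simp at this
    have e2 : below (A.erase r) i = below A i := by
      ext k
      simp only [below, Finset.mem_filter, Finset.mem_erase]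
      constructor
      · rintro ⟨⟨_, h2⟩, h3⟩; exact ⟨h2, h3⟩
      · rintro ⟨h2, h3⟩
        refine ⟨⟨?_, h2⟩, h3⟩
        rintro rfl
        exact hri h3
    rw [e2]
    cases hT : T r
    · simp
    · simp [psign_flip, hil]

lemma jw_single_zero {n : ℕ} [NeZero n] {A : Finset (Fin n)} (h : (0 : Fin n) ∈ A) :
    jw A (Pi.single 0 1) = onQubit 0 xMatrix := by
  ext T S
  simp only [jw, Matrix.of_apply]
  rw [Finset.sum_eq_single_of_mem _ h]
  · have h0 : below A (0 : Fin n) = ∅ := by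
      ext k; simp [below]
    rw [h0]
    simp only [onQubit, Matrix.of_apply, xMatrix, psign, Finset.prod_empty, Pi.single_eq_same]
    by_cases hk : ∀ k, k ≠ 0 → T k = S k
    · rw [if_pos hk]
      have : S = flip T 0 ↔ T 0 = !S 0 := by
        constructor
        · rintro rfl; simp
        · intro e
          funext k
          by_cases hk0 : k = 0
          · subst hk0; simp [e]
          · rw [flip_ne _ hk0, hk k hk0]
      simp [this]
    · rw [if_neg hk, if_neg]
      rintro rfl
      exact hk fun k h1 => by rw [flip_ne _ h1]
  · intro i _ hi
    simp [Pi.single_eq_of_ne hi]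

/-- The sign of FBS is read off the input string, that of `signedRbs` off the output string. They
agree because the gate changes no bit strictly between its two qubits; evenness of cosine and
oddness of sine move the sign out of the angle. -/
lemma BeamSplitter.fbs_eq {n : ℕ} (b : BeamSplitter n) (h : b.fst < b.snd) :
    b.fbs = signedRbs (betw Finset.univ b.fst b.snd) b.fst b.snd b.angle := by
  ext T S
  simp only [BeamSplitter.fbs, Matrix.of_apply]
  rw [onPair_rbs_apply b.ne]
  simp only [signedRbs, Matrix.of_apply]
  have e1 : ((-1 : ℝ) ^ onesBetween b.fst b.snd S : ℝ) = 1 ∨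
      ((-1 : ℝ) ^ onesBetween b.fst b.snd S : ℝ) = -1 := neg_one_pow_eq_or ℝ _
  have e2 : psign (betw Finset.univ b.fst b.snd) S =
      (((-1 : ℝ) ^ onesBetween b.fst b.snd S : ℝ) : ℂ) := by
    have e3 : onesBetween b.fst b.snd S =
        ((betw Finset.univ b.fst b.snd).filter fun k => S k = true).card := by
      simp only [onesBetween, betw, Finset.filter_filter, min_eq_left h.le, max_eq_right h.le,
        and_assoc]
    rw [e3, psign]
    simp only [zsign]
    rw [Finset.prod_ite, Finset.prod_const, Finset.prod_const_one, mul_one]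
    push_cast
    rfl
  have hc : Real.cos ((-1 : ℝ) ^ onesBetween b.fst b.snd S * b.angle) = Real.cos b.angle := by
    rcases e1 with e | e <;> simp [e]
  have hs : Real.sin ((-1 : ℝ) ^ onesBetween b.fst b.snd S * b.angle) =
      (-1 : ℝ) ^ onesBetween b.fst b.snd S * Real.sin b.angle := by
    rcases e1 with e | e <;> simp [e]
  rw [hc, hs]
  congr 1
  by_cases hS : S = flip (flip T b.fst) b.snd
  · have e4 : psign (betw Finset.univ b.fst b.snd) S = psign (betw Finset.univ b.fst b.snd) T := by
      rw [hS, psign_flip, psign_flip, if_neg, if_neg] <;> simp [betw]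
    rw [if_pos hS, if_pos hS, ← e4, e2]
    simp only [psign, Finset.prod_empty, mul_one, Complex.ofReal_mul, mul_assoc]
  · rw [if_neg hS, if_neg hS]

lemma flip_flip_bitsOf {n : ℕ} {l r : Fin n} (h : l ≠ r) :
    flip (flip (bitsOf {l}) l) r = bitsOf {r} := by
  funext k
  by_cases hr : k = r
  · subst hr; simp [flip_ne _ h.symm, bitsOf, h.symm]
  · rw [flip_ne _ hr]
    by_cases hl : k = l
    · subst hl; simp [bitsOf, hr]
    · rw [flip_ne _ hl]; simp [bitsOf, hl, hr]

/-- On strings with a single one the gate is the same Givens rotation that acts on the coefficients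
of `jw`. Hence one list of beam splitters serves both as data loader and as Clifford loader. -/
lemma onPair_rbs_mulVec_unary {n : ℕ} {l r : Fin n} (h : l ≠ r) (θ : ℝ) (w : Fin n → ℝ) :
    onPair l r (rbsMatrix θ) *ᵥ unary w = unary (givens l r θ w) := by
  have hket : ∀ (S : Bits n), signedRbs ∅ l r θ *ᵥ ket S = if S l = S r then ket S else
      (Real.cos θ : ℂ) • ket S - (zsign (S l) * Real.sin θ : ℂ) • ket (flip (flip S l) r) := by
    intro S
    funext T
    rw [signedRbs_mulVec]
    have e : S = flip (flip T l) r ↔ T = flip (flip S l) r := by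
      constructor <;> rintro rfl <;> rw [flip_comm, flip_flip, flip_flip]
    by_cases hT : T = S
    · subst hT
      split_ifs with h1
      · rfl
      · have h2 : T ≠ flip (flip T l) r := by
          intro h2
          have := congrFun h2 r
          simp [flip_ne _ h.symm] at this
        simp [ket, h2, h2.symm]
    · by_cases hT' : T = flip (flip S l) r
      · have hT2 := e.2 hT'
        rw [← hT2]
        have hl : T l = !S l := by rw [hT', flip_ne _ h, flip_self]
        have hr : T r = !S r := by rw [hT', flip_self, flip_ne _ h.symm]
        rw [hl, hr, zsign_not]
        have hb : ((!S l) = !S r) ↔ S l = S r := by cases S l <;> cases S r <;> simp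
        simp only [hb]
        rw [← hT']
        split_ifs with h1
        · rfl
        · simp [ket, hT, psign]
      · have hT2 : ¬ flip (flip T l) r = S := fun h2 => hT' (e.1 h2.symm)
        split_ifs <;> simp [ket, hT, hT', hT2]
  have hoff : ∀ i, i ≠ l → i ≠ r →
      onPair l r (rbsMatrix θ) *ᵥ ket (bitsOf {i}) = ket (bitsOf {i}) := by
    intro i hl hr
    rw [onPair_rbs h, hket, if_pos]
    simp [bitsOf, hl.symm, hr.symm]
  have hle : onPair l r (rbsMatrix θ) *ᵥ ket (bitsOf {l}) =
      (Real.cos θ : ℂ) • ket (bitsOf {l}) + (Real.sin θ : ℂ) • ket (bitsOf {r}) := by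
    rw [onPair_rbs h, hket, if_neg, flip_flip_bitsOf h]
    · simp [bitsOf, zsign]
    · simp [bitsOf, h.symm]
  have hre : onPair l r (rbsMatrix θ) *ᵥ ket (bitsOf {r}) =
      (Real.cos θ : ℂ) • ket (bitsOf {r}) - (Real.sin θ : ℂ) • ket (bitsOf {l}) := by
    rw [onPair_rbs h, hket, if_neg, flip_comm, flip_flip_bitsOf h.symm]
    · simp [bitsOf, zsign, h]
    · simp [bitsOf, h]
  have hr' : r ∈ Finset.univ.erase l := by simp [h.symm]
  have split : ∀ f : Fin n → (Bits n → ℂ), ∑ i, f i =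
      f l + (f r + ∑ i ∈ (Finset.univ.erase l).erase r, f i) := fun f => by
    rw [Finset.add_sum_erase _ _ hr', Finset.add_sum_erase _ _ (Finset.mem_univ l)]
  simp only [unary]
  rw [Matrix.mulVec_sum, split, split]
  simp only [Matrix.mulVec_smul]
  have hrest : ∑ i ∈ (Finset.univ.erase l).erase r,
      (w i : ℂ) • onPair l r (rbsMatrix θ) *ᵥ ket (bitsOf {i}) =
      ∑ i ∈ (Finset.univ.erase l).erase r, (givens l r θ w i : ℂ) • ket (bitsOf {i}) := by
    refine Finset.sum_congr rfl fun i hi => ?_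
    rw [Finset.mem_erase, Finset.mem_erase] at hi
    rw [hoff i hi.2.1 hi.1]
    simp [givens, hi.1, hi.2.1]
  rw [hrest, hle, hre]
  have gl : givens l r θ w l = Real.cos θ * w l - Real.sin θ * w r := by simp [givens]
  have gr : givens l r θ w r = Real.sin θ * w l + Real.cos θ * w r := by simp [givens, h.symm]
  rw [gl, gr]
  push_cast
  module

/-! ## Tree-shaped circuits for Clifford loaders -/

lemma seqOp_append {n : ℕ} (a b : List (Op n)) : seqOp (a ++ b) = seqOp b * seqOp a := by
  induction a with
  | nil => simp [seqOp]
  | cons U l ih => simp [seqOp, ih, mul_assoc]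

/-- The operator `M` equals `jw A w`, and some circuit of beam splitters loads `w` and induces the
Clifford loader `jw univ w`. -/
def Loads {n : ℕ} [NeZero n] (A : Finset (Fin n)) (M : Op n) (w : Fin n → ℝ) : Prop :=
  M = jw A w ∧ ∃ D : List (BeamSplitter n),
    IsUnaryDataLoader D w ∧ cliffordLoader D = jw Finset.univ w

lemma loads_x {n : ℕ} [NeZero n] {A : Finset (Fin n)} (h : (0 : Fin n) ∈ A) :
    Loads A (onQubit 0 xMatrix) (Pi.single 0 1) := by
  refine ⟨(jw_single_zero h).symm, [], ?_, ?_⟩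
  · simp only [IsUnaryDataLoader, List.map_nil, seqOp, Matrix.one_mulVec, unary]
    rw [Finset.sum_eq_single_of_mem _ (Finset.mem_univ 0)]
    · simp
    · intro i _ hi
      simp [Pi.single_eq_of_ne hi]
  · simp [cliffordLoader, seqOp, jw_single_zero]

/-- One rotation is carried out twice: on `A`, where `l` and `r` are neighbours, by a plain RBS in
the circuit, and on all qubits by the FBS gate appended to the witness list. -/
lemma Loads.rbs {n : ℕ} [NeZero n] {A : Finset (Fin n)} {M : Op n} {w : Fin n → ℝ}
    (hM : Loads A M w) {l r : Fin n} (h : l < r) (hl : l ∈ A) (hr : r ∈ A) (hA : betw A l r = ∅)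
    (θ : ℝ) :
    Loads A (onPair l r (rbsMatrix θ) * M * onPair r l (rbsMatrix θ)) (givens l r θ w) := by
  obtain ⟨hM, D, hD, hc⟩ := hM
  constructor
  · have := jw_givens_mul_signedRbs h hl hr θ w
    rw [hA] at this
    rw [onPair_rbs h.ne, onPair_rbs h.ne', signedRbs_swap (l := l) (r := r), hM, ← this, mul_assoc,
      signedRbs_mul_neg h.ne (by simp) (by simp), mul_one]
  · refine ⟨D ++ [⟨l, r, h.ne, θ⟩], ?_, ?_⟩
    · rw [IsUnaryDataLoader] at hD ⊢
      rw [List.map_append, seqOp_append, ← Matrix.mulVec_mulVec, hD]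
      simp only [List.map_cons, List.map_nil, seqOp, one_mul, BeamSplitter.rbs]
      exact onPair_rbs_mulVec_unary h.ne θ w
    · rw [cliffordLoader] at hc ⊢
      have hb := BeamSplitter.fbs_eq ⟨l, r, h.ne, θ⟩ h
      have := jw_givens_mul_signedRbs h (Finset.mem_univ l) (Finset.mem_univ r) θ w
      rw [List.map_append, seqOp_append, Matrix.conjTranspose_mul]
      simp only [List.map_cons, List.map_nil, seqOp, one_mul, hb]
      rw [signedRbs_conjTranspose h.ne (by simp [betw]) (by simp [betw]), mul_assoc, mul_assoc,
        ← mul_assoc _ _ (signedRbs _ _ _ _),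
        ← mul_assoc _ _ (signedRbs _ _ _ _), ← mul_assoc (seqOp _), hc, ← mul_assoc, ← this,
        mul_assoc, signedRbs_mul_neg h.ne (by simp [betw]) (by simp [betw]), mul_one]

/-- CX gates change only the active set, not the coefficients, so the witness list stays as it is.
-/
lemma Loads.cx {n : ℕ} [NeZero n] {A : Finset (Fin n)} {M : Op n} {w : Fin n → ℝ} {l r : Fin n}
    (hM : Loads (A.erase r) M w) (h : l < r) (hl : l ∈ A) (hr : r ∈ A) (hA : betw A l r = ∅)
    (hw : w r = 0) : Loads A (onPair r l cxMatrix * M * onPair r l cxMatrix) w := by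
  refine ⟨?_, hM.2⟩
  rw [hM.1, mul_assoc, jw_erase_mul_cx h hl hr hA w hw, ← mul_assoc, onPair_cx_mul_self h.ne',
    one_mul]

/-! ### Merging pairs of qubits layer by layer -/

/-- A pair of qubits to be merged, with the parameter of a beam splitter. -/
structure MergePair (n : ℕ) (α : Type) : Type where
  fst : Fin n
  snd : Fin n
  lt : fst < snd
  angle : α

namespace MergePair

variable {n : ℕ} {α β : Type}

def rbs (g : MergePair n α) : Gate n α := .rbs g.fst g.snd g.lt.ne g.angle

/-- Exchanging the two qubits inverts the gate (`signedRbs_swap`). A parameter in a layout is only a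
name and cannot be negated, so this is how gate and inverse share one parameter. -/
def rbsInv (g : MergePair n α) : Gate n α := .rbs g.snd g.fst g.lt.ne' g.angle

def cx (g : MergePair n α) : Gate n α := .cx g.snd g.fst g.lt.ne'

def map (f : α → β) (g : MergePair n α) : MergePair n β := ⟨g.fst, g.snd, g.lt, f g.angle⟩

/-- The two pairs have no qubit in common. -/
def Disj (g h : MergePair n α) : Prop :=
  Disjoint ({g.fst, g.snd} : Finset (Fin n)) {h.fst, h.snd}

end MergePair

/-- The unitary implemented by a sequence of gates. -/
noncomputable def gatesOp {n : ℕ} (gs : List (Gate n ℝ)) : Op n := seqOp (gs.map Gate.op)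

lemma gatesOp_conj {n : ℕ} (g h : Gate n ℝ) (gs : List (Gate n ℝ)) :
    gatesOp (g :: gs ++ [h]) = h.op * gatesOp gs * g.op := by
  simp [gatesOp, seqOp, seqOp_append, mul_assoc]

lemma layer_conj {n : ℕ} {ι : Type} (a b : ι → Gate n ℝ) (g : ι) (t : List ι)
    (mid : List (Gate n ℝ)) :
    gatesOp ((g :: t).map a ++ mid ++ (g :: t).reverse.map b) =
      (b g).op * gatesOp (t.map a ++ mid ++ t.reverse.map b) * (a g).op := by
  rw [← gatesOp_conj]
  simp

lemma loads_cx_layer {n : ℕ} [NeZero n] (mid : List (Gate n ℝ)) (w : Fin n → ℝ)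
    (A' : Finset (Fin n)) (ps : List (MergePair n ℝ)) : ∀ A : Finset (Fin n),
    (∀ g ∈ ps, g.fst ∈ A ∧ g.snd ∈ A ∧ betw A g.fst g.snd = ∅ ∧ w g.snd = 0) →
    ps.Pairwise MergePair.Disj → (∀ p, p ∈ A' ↔ p ∈ A ∧ ∀ g ∈ ps, p ≠ g.snd) →
    Loads A' (gatesOp mid) w →
    Loads A (gatesOp (ps.map MergePair.cx ++ mid ++ ps.reverse.map MergePair.cx)) w := by
  induction ps with
  | nil =>
    intro A _ _ hA' h
    have : A' = A := by ext p; simp [hA' p]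
    subst this
    simpa using h
  | cons g t ih =>
    intro A hps hd hA' h
    rw [layer_conj]
    obtain ⟨h1, h2, h3, h4⟩ := hps g (by simp)
    rw [List.pairwise_cons] at hd
    refine Loads.cx (ih (A.erase g.snd) ?_ hd.2 ?_ h) g.lt h1 h2 h3 h4
    · intro g' hg'
      obtain ⟨h1', h2', h3', h4'⟩ := hps g' (by simp [hg'])
      have hdis := hd.1 g' hg'
      simp only [MergePair.Disj, Finset.disjoint_insert_left, Finset.disjoint_singleton_left,
        Finset.mem_insert, Finset.mem_singleton, not_or] at hdis
      refine ⟨Finset.mem_erase.2 ⟨Ne.symm hdis.2.1, h1'⟩,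
        Finset.mem_erase.2 ⟨Ne.symm hdis.2.2, h2'⟩, ?_, h4'⟩
      apply Finset.subset_empty.1
      rw [← h3']
      exact Finset.filter_subset_filter _ (Finset.erase_subset _ _)
    · intro p
      rw [hA' p, Finset.mem_erase]
      simp only [List.mem_cons, forall_eq_or_imp]
      tauto

lemma loads_rbs_layer {n : ℕ} [NeZero n] (mid : List (Gate n ℝ)) (w' : Fin n → ℝ)
    (A : Finset (Fin n)) (hmid : Loads A (gatesOp mid) w') (ps : List (MergePair n ℝ)) :
    ∀ w : Fin n → ℝ,
    (∀ g ∈ ps, g.fst ∈ A ∧ g.snd ∈ A ∧ betw A g.fst g.snd = ∅ ∧ w' g.snd = 0 ∧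
      w g.fst = Real.cos g.angle * w' g.fst ∧ w g.snd = Real.sin g.angle * w' g.fst) →
    (∀ p, (∀ g ∈ ps, p ≠ g.fst ∧ p ≠ g.snd) → w p = w' p) →
    ps.Pairwise MergePair.Disj →
    Loads A (gatesOp (ps.map MergePair.rbsInv ++ mid ++ ps.reverse.map MergePair.rbs)) w := by
  induction ps with
  | nil =>
    intro w _ hw _
    have : w = w' := funext fun p => hw p (by simp)
    subst this
    simpa using hmid
  | cons g t ih =>
    intro w hps hw hd
    rw [layer_conj]
    obtain ⟨h1, h2, h3, h4, h5, h6⟩ := hps g (by simp)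
    rw [List.pairwise_cons] at hd
    -- The pair `g` is outermost, so its rotation comes last; `w1` is the vector before that
    -- rotation, which still has the inner coefficients at the two qubits of `g`.
    set w1 := Function.update (Function.update w g.fst (w' g.fst)) g.snd (w' g.snd) with hw1
    have hne := g.lt.ne
    have hw1l : w1 g.fst = w' g.fst := by simp [hw1, Function.update_of_ne hne]
    have hw1r : w1 g.snd = w' g.snd := by simp [hw1]
    have hw1o : ∀ p, p ≠ g.fst → p ≠ g.snd → w1 p = w p := by
      intro p hp1 hp2
      simp [hw1, Function.update_of_ne hp1, Function.update_of_ne hp2]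
    have hw1w : givens g.fst g.snd g.angle w1 = w := by
      funext p
      simp only [givens]
      split_ifs with e1 e2
      · rw [e1, hw1l, hw1r, h4, h5]; ring
      · rw [e2, hw1l, hw1r, h4, h6]; ring
      · exact hw1o p e1 e2
    rw [← hw1w]
    refine Loads.rbs (ih w1 ?_ ?_ hd.2) g.lt h1 h2 h3 g.angle
    · intro g' hg'
      obtain ⟨h1', h2', h3', h4', h5', h6'⟩ := hps g' (by simp [hg'])
      have hdis := hd.1 g' hg'
      simp only [MergePair.Disj, Finset.disjoint_insert_left, Finset.disjoint_singleton_left,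
        Finset.mem_insert, Finset.mem_singleton, not_or] at hdis
      refine ⟨h1', h2', h3', h4', ?_, ?_⟩
      · rw [hw1o _ (Ne.symm hdis.1.1) (Ne.symm hdis.2.1), h5']
      · rw [hw1o _ (Ne.symm hdis.1.2) (Ne.symm hdis.2.2), h6']
    · intro p hp
      by_cases e1 : p = g.fst
      · rw [e1, hw1l]
      by_cases e2 : p = g.snd
      · rw [e2, hw1r]
      rw [hw1o p e1 e2]
      refine hw p fun g' hg' => ?_
      rcases List.mem_cons.1 hg' with rfl | hg'
      · exact ⟨e1, e2⟩
      · exact hp g' hg'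

/-- The circuit that merges the pairs of the given layers, applies `X` to the qubit `i`, and
undoes the merging. -/
def treeCircuit {n : ℕ} {α : Type} (i : Fin n) : List (List (MergePair n α)) → Circuit n α
  | [] => [[.x i]]
  | ps :: L => [ps.map MergePair.rbsInv, ps.map MergePair.cx] ++ treeCircuit i L ++
      [ps.reverse.map MergePair.cx, ps.reverse.map MergePair.rbs]

lemma treeCircuit_fill {n : ℕ} {α β : Type} (i : Fin n) (f : α → β)
    (L : List (List (MergePair n α))) :
    (treeCircuit i L).fill f = treeCircuit i (L.map (List.map (MergePair.map f))) := by
  induction L with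
  | nil => simp [treeCircuit, Circuit.fill, Gate.map]
  | cons ps L ih =>
    simp only [treeCircuit, List.map_cons, ← ih]
    simp [Circuit.fill, Function.comp_def, MergePair.rbsInv, MergePair.cx, MergePair.rbs, Gate.map,
      MergePair.map]

lemma treeCircuit_depth {n : ℕ} {α : Type} (i : Fin n) (L : List (List (MergePair n α))) :
    (treeCircuit i L).depth = 4 * L.length + 1 := by
  induction L with
  | nil => simp [treeCircuit, Circuit.depth]
  | cons ps L ih =>
    simp only [Circuit.depth] at ih
    simp [treeCircuit, Circuit.depth, ih]
    ring

lemma treeCircuit_size {n : ℕ} {α : Type} (i : Fin n) (L : List (List (MergePair n α))) (m : ℕ)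
    (h : ∀ ps ∈ L, ps.length ≤ m) : (treeCircuit i L).size ≤ 4 * m * L.length + 1 := by
  induction L with
  | nil => simp [treeCircuit, Circuit.size]
  | cons ps L ih =>
    have h1 := ih fun ps' hps' => h ps' (by simp [hps'])
    have h2 := h ps (by simp)
    simp only [Circuit.size] at h1
    simp only [treeCircuit, Circuit.size, List.flatten_append, List.length_append,
      List.length_cons, List.flatten_cons, List.length_map, List.flatten_nil, List.length_nil,
      List.length_reverse]
    nlinarith

lemma treeCircuit_isParallel {n : ℕ} {α : Type} (i : Fin n) (L : List (List (MergePair n α)))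
    (h : ∀ ps ∈ L, ps.Pairwise MergePair.Disj) : (treeCircuit i L).IsParallel := by
  have key : ∀ (a : MergePair n α → Gate n α),
      (∀ g, (a g).support = {g.fst, g.snd}) → ∀ ps : List (MergePair n α),
      ps.Pairwise MergePair.Disj →
      (ps.map a).Pairwise fun g g' => Disjoint g.support g'.support := by
    intro a ha ps hps
    rw [List.pairwise_map]
    refine hps.imp ?_
    intro g g' hg
    rw [ha, ha]
    exact hg
  have k1 := key MergePair.rbs fun g => rfl
  have k2 := key MergePair.rbsInv fun g => Finset.pair_comm _ _
  have k3 := key MergePair.cx fun g => Finset.pair_comm _ _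
  have hrev : ∀ ps : List (MergePair n α), ps.Pairwise MergePair.Disj →
      ps.reverse.Pairwise MergePair.Disj := by
    intro ps hps
    rw [List.pairwise_reverse]
    exact hps.imp fun {a b} h => Disjoint.symm h
  induction L with
  | nil => simp [treeCircuit, Circuit.IsParallel]
  | cons ps L ih =>
    have h1 := ih fun ps' hps' => h ps' (by simp [hps'])
    have h2 := h ps (by simp)
    intro l hl
    simp only [treeCircuit, List.mem_append, List.mem_cons, List.not_mem_nil, or_false] at hl
    rcases hl with ((rfl | rfl) | hl) | rfl | rfl
    · exact k2 _ h2
    · exact k3 _ h2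
    · exact h1 l hl
    · exact k3 _ (hrev _ h2)
    · exact k1 _ (hrev _ h2)

/-! ### The layout and the heaps that supply its angles -/

/-- The pairs `(l, l + 2 ^ k)` with `l` a multiple of `2 ^ (k + 1)`. The angles are numbered by the
inner nodes of a binary heap with `2 ^ K` leaves. -/
def mergeLayer (n K k : ℕ) : List (MergePair n ℕ) :=
  (List.finRange n).filterMap fun r =>
    if h : r.val % 2 ^ (k + 1) = 2 ^ k then
      some ⟨⟨r.val - 2 ^ k, (Nat.sub_le _ _).trans_lt r.2⟩, r,
        Fin.lt_def.2 (Nat.sub_lt (lt_of_lt_of_le (Nat.two_pow_pos k) (h ▸ Nat.mod_le _ _))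
          (Nat.two_pow_pos k)), 2 ^ (K - 1 - k) + r.val / 2 ^ (k + 1)⟩
    else none

lemma mem_mergeLayer {n K k : ℕ} {g : MergePair n ℕ} (hg : g ∈ mergeLayer n K k) :
    g.snd.val % 2 ^ (k + 1) = 2 ^ k ∧ g.fst.val = g.snd.val - 2 ^ k ∧
      g.angle = 2 ^ (K - 1 - k) + g.snd.val / 2 ^ (k + 1) := by
  rw [mergeLayer, List.mem_filterMap] at hg
  obtain ⟨r, _, hr⟩ := hg
  split_ifs at hr with h
  rw [Option.some_inj] at hr
  subst hr
  exact ⟨h, rfl, rfl⟩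

lemma exists_mem_mergeLayer {n : ℕ} (K : ℕ) {k : ℕ} (r : Fin n) (h : r.val % 2 ^ (k + 1) = 2 ^ k) :
    ∃ g ∈ mergeLayer n K k, g.snd = r := by
  refine ⟨_, List.mem_filterMap.2 ⟨r, List.mem_finRange r, dif_pos h⟩, rfl⟩

lemma mem_mergeLayer_exists {n K k : ℕ} {g : MergePair n ℕ} (hg : g ∈ mergeLayer n K k) :
    ∃ q, g.fst.val = 2 ^ (k + 1) * q ∧ g.snd.val = 2 ^ (k + 1) * q + 2 ^ k ∧
      g.angle = 2 ^ (K - 1 - k) + q := by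
  obtain ⟨h1, h2, h3⟩ := mem_mergeLayer hg
  refine ⟨g.snd.val / 2 ^ (k + 1), ?_, ?_, h3⟩
  · have := Nat.div_add_mod g.snd.val (2 ^ (k + 1))
    omega
  · have := Nat.div_add_mod g.snd.val (2 ^ (k + 1))
    omega

lemma mergeLayer_length (n K k : ℕ) : (mergeLayer n K k).length ≤ n := by
  refine (List.length_filterMap_le _ _).trans ?_
  simp

/-- Modulo `2 ^ (k + 1)` every left end is 0 and every right end is `2 ^ k`, so left and right ends
never meet; distinct right ends have distinct left ends. -/
lemma mergeLayer_pairwise (n K k : ℕ) : (mergeLayer n K k).Pairwise MergePair.Disj := by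
  rw [mergeLayer, List.pairwise_filterMap]
  refine (List.nodup_finRange n).imp ?_
  intro r r' hne g hg g' hg'
  split_ifs at hg with h
  split_ifs at hg' with h'
  rw [Option.some_inj] at hg hg'
  subst hg hg'
  have hne' : r.val ≠ r'.val := fun e => hne (Fin.ext e)
  have e1 := Nat.div_add_mod r.val (2 ^ (k + 1))
  have e2 := Nat.div_add_mod r'.val (2 ^ (k + 1))
  have hpos := Nat.two_pow_pos k
  have m1 : (r.val - 2 ^ k) % 2 ^ (k + 1) = 0 := by
    have : r.val - 2 ^ k = 2 ^ (k + 1) * (r.val / 2 ^ (k + 1)) := by omega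
    rw [this, Nat.mul_mod_right]
  have m2 : (r'.val - 2 ^ k) % 2 ^ (k + 1) = 0 := by
    have : r'.val - 2 ^ k = 2 ^ (k + 1) * (r'.val / 2 ^ (k + 1)) := by omega
    rw [this, Nat.mul_mod_right]
  simp only [MergePair.Disj, Finset.disjoint_insert_left, Finset.disjoint_singleton_left,
    Finset.mem_insert, Finset.mem_singleton, not_or, Fin.ext_iff]
  refine ⟨⟨?_, ?_⟩, ?_, ?_⟩
  · omega
  · intro e
    rw [e] at m1
    omega
  · intro e
    rw [← e] at m2
    omega
  · exact hne'

/-- The layout of a Clifford loader on `n` qubits. -/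
def loaderLayout (n : ℕ) : Circuit n ℕ :=
  if h : 0 < n then
    treeCircuit ⟨0, h⟩ ((List.range (Nat.clog 2 n)).map (mergeLayer n (Nat.clog 2 n)))
  else []

/-- The values `W` at the nodes of a binary heap with `2 ^ K` leaves and the angles `f` at its inner
nodes encode the vector with entries `x` in the leaves. -/
structure HeapEncodes (n K : ℕ) (x : ℕ → ℝ) (W f : ℕ → ℝ) : Prop where
  root : W 1 = 1
  leaf : ∀ p < n, W (2 ^ K + p) = x p
  leaf_zero : ∀ p, n ≤ p → p < 2 ^ K → W (2 ^ K + p) = 0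
  cos : ∀ i, 1 ≤ i → i < 2 ^ K → W (2 * i) = Real.cos (f i) * W i
  sin : ∀ i, 1 ≤ i → i < 2 ^ K → W (2 * i + 1) = Real.sin (f i) * W i
  -- A pair whose right qubit would be at least `n` has no gate, so such a node must pass on its
  -- value unchanged, with its sign. The root is exempt: its value is fixed to be 1, and its pair is
  -- always present.
  eq_left : ∀ i, 2 ≤ i → i < 2 ^ K → W (2 * i + 1) = 0 → W i = W (2 * i)

/-- The node `2 ^ (K - k) + q` lies above the leaves from `q * 2 ^ k` on. Its square is the sum of
the squares of its children, so it vanishes if all these leaves lie beyond `n`. -/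
lemma HeapEncodes.eq_zero {n K : ℕ} {x W f : ℕ → ℝ} (h : HeapEncodes n K x W f) (k : ℕ) :
    ∀ q, k ≤ K → q < 2 ^ (K - k) → n ≤ q * 2 ^ k → W (2 ^ (K - k) + q) = 0 := by
  induction k with
  | zero =>
    intro q _ hq hn
    exact h.leaf_zero q (by simpa using hn) hq
  | succ k ih =>
    intro q hk hq hn
    have e : 2 ^ (K - k) = 2 * 2 ^ (K - (k + 1)) := by
      rw [← pow_succ']; congr 1; omega
    have hle : 2 ^ (K - k) ≤ 2 ^ K := Nat.pow_le_pow_right (by norm_num) (by omega)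
    have hpos := Nat.two_pow_pos (K - (k + 1))
    have h1 := ih (2 * q) (by omega) (by omega) (by rw [pow_succ] at hn; linarith)
    have h2 := ih (2 * q + 1) (by omega) (by omega)
      (by rw [pow_succ] at hn; nlinarith [Nat.two_pow_pos k])
    have c := h.cos (2 ^ (K - (k + 1)) + q) (by omega) (by omega)
    have s := h.sin (2 ^ (K - (k + 1)) + q) (by omega) (by omega)
    rw [show 2 * (2 ^ (K - (k + 1)) + q) = 2 ^ (K - k) + 2 * q by rw [e]; ring, h1] at c
    rw [show 2 * (2 ^ (K - (k + 1)) + q) + 1 = 2 ^ (K - k) + (2 * q + 1) by rw [e]; ring, h2] at s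
    have := Real.cos_sq_add_sin_sq (f (2 ^ (K - (k + 1)) + q))
    have h3 : W (2 ^ (K - (k + 1)) + q) ^ 2 = 0 := by
      calc W (2 ^ (K - (k + 1)) + q) ^ 2 = (Real.cos (f (2 ^ (K - (k + 1)) + q)) *
            W (2 ^ (K - (k + 1)) + q)) ^ 2 + (Real.sin (f (2 ^ (K - (k + 1)) + q)) *
            W (2 ^ (K - (k + 1)) + q)) ^ 2 := by rw [mul_pow, mul_pow, ← add_mul, this, one_mul]
        _ = 0 := by rw [← c, ← s]; ring
    exact pow_eq_zero_iff (two_ne_zero) |>.1 h3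

/-- The coefficients at level `k` of the heap. -/
noncomputable def levelCoeff (n K k : ℕ) (W : ℕ → ℝ) : Fin n → ℝ := fun p =>
  if 2 ^ k ∣ p.val then W (2 ^ (K - k) + p.val / 2 ^ k) else 0

/-- The qubits that are still active at level `k`. -/
def levelSet (n k : ℕ) : Finset (Fin n) := Finset.univ.filter fun p => 2 ^ k ∣ p.val

lemma betw_levelSet {n k : ℕ} {l r : Fin n} {q : ℕ} (hl : l.val = 2 ^ (k + 1) * q)
    (hr : r.val = 2 ^ (k + 1) * q + 2 ^ k) : betw (levelSet n k) l r = ∅ := by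
  apply Finset.filter_eq_empty_iff.2
  rintro p hp ⟨h1, h2⟩
  rw [levelSet, Finset.mem_filter] at hp
  obtain ⟨c, hc⟩ := hp.2
  rw [Fin.lt_def] at h1 h2
  rw [hl, hc, pow_succ, mul_assoc] at h1
  rw [hr, hc, pow_succ, mul_assoc, ← Nat.mul_succ] at h2
  have := lt_of_mul_lt_mul_left h1 (Nat.zero_le _)
  have := lt_of_mul_lt_mul_left h2 (Nat.zero_le _)
  omega

/-- Induction from the root of the heap to the leaves. At `k = K` only qubit 0 is active and the
operator is X. Going from `k + 1` to `k`, the CX layers bring back the odd multiples of `2 ^ k` with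
coefficient 0, and the RBS layers distribute each node over its two children. -/
lemma loads_layers {n K : ℕ} [NeZero n] {x W f : ℕ → ℝ} (h : HeapEncodes n K x W f)
    (hn : n ≤ 2 ^ K) (hn' : 2 ^ (K - 1) < n) (m : ℕ) : ∀ k, k + m = K →
    Loads (levelSet n k) (gatesOp (List.flatten (treeCircuit 0
      ((List.range' k m).map fun k => (mergeLayer n K k).map (MergePair.map f)))))
      (levelCoeff n K k W) := by
  induction m with
  | zero =>
    intro k hk
    obtain rfl : k = K := by omega
    have : levelCoeff n k k W = Pi.single 0 1 := by
      funext p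
      by_cases hp : p = 0
      · subst hp
        simp [levelCoeff, h.root]
      · rw [Pi.single_eq_of_ne hp, levelCoeff, if_neg]
        intro hd
        have h1 : p.val ≠ 0 := fun e => hp (Fin.ext (by simpa using e))
        exact absurd (Nat.le_of_dvd (Nat.pos_of_ne_zero h1) hd) (by have := p.2; omega)
    rw [this]
    have h2 := loads_x (A := levelSet n k) (by simp [levelSet])
    simpa [treeCircuit, gatesOp, seqOp, Gate.op] using h2
  | succ m ih =>
    intro k hk
    have ih := ih (k + 1) (by omega)
    have hpk := Nat.two_pow_pos k
    have e1 : 2 ^ (K - k) = 2 * 2 ^ (K - (k + 1)) := by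
      rw [← pow_succ']; congr 1; omega
    have e2 : 2 ^ K = 2 ^ (K - (k + 1)) * 2 ^ (k + 1) := by
      rw [← pow_add]; congr 1; omega
    have eK : K - 1 - k = K - (k + 1) := by omega
    have hle : 2 ^ (K - k) ≤ 2 ^ K := Nat.pow_le_pow_right (by norm_num) (by omega)
    have hqlt : ∀ q, 2 ^ (k + 1) * q < n → q < 2 ^ (K - (k + 1)) := by
      intro q hq
      by_contra hcon
      have := Nat.mul_le_mul_left (2 ^ (k + 1)) (not_lt.1 hcon)
      rw [mul_comm, ← e2] at this
      omega
    have val_even : ∀ (p : Fin n) q, p.val = 2 ^ (k + 1) * q →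
        levelCoeff n K k W p = W (2 * (2 ^ (K - (k + 1)) + q)) := by
      intro p q hp
      have hp' : p.val = 2 ^ k * (2 * q) := by rw [hp]; ring
      rw [levelCoeff, if_pos ⟨_, hp'⟩, hp', Nat.mul_div_cancel_left _ hpk, e1]
      congr 1; ring
    have val_odd : ∀ (p : Fin n) q, p.val = 2 ^ (k + 1) * q + 2 ^ k →
        levelCoeff n K k W p = W (2 * (2 ^ (K - (k + 1)) + q) + 1) := by
      intro p q hp
      have hp' : p.val = 2 ^ k * (2 * q + 1) := by rw [hp]; ring
      rw [levelCoeff, if_pos ⟨_, hp'⟩, hp', Nat.mul_div_cancel_left _ hpk, e1]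
      congr 1; ring
    have val_next : ∀ (p : Fin n) q, p.val = 2 ^ (k + 1) * q →
        levelCoeff n K (k + 1) W p = W (2 ^ (K - (k + 1)) + q) := by
      intro p q hp
      rw [levelCoeff, if_pos ⟨_, hp⟩, hp, Nat.mul_div_cancel_left _ (Nat.two_pow_pos _)]
    have next_odd : ∀ (p : Fin n) q, p.val = 2 ^ (k + 1) * q + 2 ^ k →
        ¬ 2 ^ (k + 1) ∣ p.val := by
      rintro p q hp hd
      rw [hp, Nat.dvd_add_right ⟨q, rfl⟩] at hd
      have := Nat.le_of_dvd hpk hd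
      rw [pow_succ] at this
      omega
    have cases_mod : ∀ p : Fin n, 2 ^ k ∣ p.val →
        (∃ q, p.val = 2 ^ (k + 1) * q) ∨ ∃ q, p.val = 2 ^ (k + 1) * q + 2 ^ k := by
      rintro p ⟨c, hc⟩
      rcases Nat.even_or_odd' c with ⟨q, rfl | rfl⟩
      · exact Or.inl ⟨q, by rw [hc]; ring⟩
      · exact Or.inr ⟨q, by rw [hc]; ring⟩
    have mem_of_odd : ∀ (p : Fin n) q, p.val = 2 ^ (k + 1) * q + 2 ^ k →
        ∃ g ∈ mergeLayer n K k, g.snd = p := by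
      intro p q hp
      refine exists_mem_mergeLayer K p ?_
      rw [hp, Nat.mul_add_mod, Nat.mod_eq_of_lt]
      rw [pow_succ]; omega
    have hpair : ((mergeLayer n K k).map (MergePair.map f)).Pairwise MergePair.Disj := by
      rw [List.pairwise_map]
      exact mergeLayer_pairwise n K k
    have hcx := loads_cx_layer _ _ (levelSet n (k + 1)) ((mergeLayer n K k).map (MergePair.map f))
      (levelSet n k) ?_ hpair ?_ ih
    · have hrbs := loads_rbs_layer _ _ _ hcx ((mergeLayer n K k).map (MergePair.map f))
        (levelCoeff n K k W) ?_ ?_ hpair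
      · rw [List.range'_succ, List.map_cons, treeCircuit]
        simpa [List.flatten_append, List.append_assoc] using hrbs
      · intro g hg
        obtain ⟨g, hg', rfl⟩ := List.mem_map.1 hg
        obtain ⟨q, h1, h2, h3⟩ := mem_mergeLayer_exists hg'
        have hq := hqlt q (h1 ▸ g.fst.2)
        refine ⟨?_, ?_, betw_levelSet h1 h2, ?_, ?_, ?_⟩
        · exact Finset.mem_filter.2 ⟨Finset.mem_univ _, 2 * q, by
            simp only [MergePair.map]; rw [h1]; ring⟩
        · exact Finset.mem_filter.2 ⟨Finset.mem_univ _, 2 * q + 1, by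
            simp only [MergePair.map]; rw [h2]; ring⟩
        · exact if_neg (next_odd _ q h2)
        · simp only [MergePair.map]
          rw [val_even _ q h1, val_next _ q h1, h3, eK]
          exact h.cos _ (by omega) (by omega)
        · simp only [MergePair.map]
          rw [val_odd _ q h2, val_next _ q h1, h3, eK]
          exact h.sin _ (by omega) (by omega)
      · intro p hp
        by_cases hd : 2 ^ k ∣ p.val
        · rcases cases_mod p hd with ⟨q, hq⟩ | ⟨q, hq⟩
          · have hq' := hqlt q (hq ▸ p.2)
            rw [val_even p q hq, val_next p q hq]
            -- An even position without a gate: its partner is beyond `n`, so the right child is 0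
            -- and `eq_left` applies.
            have hlast : n ≤ (2 * q + 1) * 2 ^ k := by
              by_contra hcon
              have hr : 2 ^ (k + 1) * q + 2 ^ k < n := by
                rw [pow_succ]; linarith
              obtain ⟨g, hg, hgs⟩ := mem_of_odd ⟨_, hr⟩ q rfl
              obtain ⟨q', h1, h2, _⟩ := mem_mergeLayer_exists hg
              refine (hp _ (List.mem_map_of_mem hg)).1 (Fin.ext ?_)
              simp only [MergePair.map]
              rw [hgs] at h2
              simp only at h2
              omega
            have hz := h.eq_zero k (2 * q + 1) (by omega) (by omega) hlast
            refine (h.eq_left _ ?_ (by omega) ?_).symm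
            -- The node cannot be the root: its partner would be the qubit `2 ^ (K - 1)`, which
            -- exists by `hn'`.
            · by_contra hcon
              have hpos := Nat.two_pow_pos (K - (k + 1))
              have hq0 : q = 0 := by omega
              have hp1 : 2 ^ (K - (k + 1)) = 1 := by omega
              have : K - (k + 1) = 0 := by
                by_contra h0
                have := Nat.one_lt_two_pow h0
                omega
              have : K - 1 = k := by omega
              subst hq0
              rw [this] at hn'
              omega
            · rw [← hz, e1]
              congr 1; ring
          · obtain ⟨g, hg, hgs⟩ := mem_of_odd p q hq
            exact absurd hgs.symm (hp _ (List.mem_map_of_mem hg)).2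
        · have hd' : ¬ 2 ^ (k + 1) ∣ p.val := fun h' => hd (dvd_trans (pow_dvd_pow 2 (by omega)) h')
          simp [levelCoeff, hd, hd']
    · intro g hg
      obtain ⟨g, hg', rfl⟩ := List.mem_map.1 hg
      obtain ⟨q, h1, h2, h3⟩ := mem_mergeLayer_exists hg'
      refine ⟨?_, ?_, betw_levelSet h1 h2, ?_⟩
      · exact Finset.mem_filter.2 ⟨Finset.mem_univ _, 2 * q, by
          simp only [MergePair.map]; rw [h1]; ring⟩
      · exact Finset.mem_filter.2 ⟨Finset.mem_univ _, 2 * q + 1, by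
          simp only [MergePair.map]; rw [h2]; ring⟩
      · exact if_neg (next_odd _ q h2)
    · intro p
      simp only [levelSet, Finset.mem_filter, Finset.mem_univ, true_and]
      constructor
      · intro hd
        refine ⟨dvd_trans (pow_dvd_pow 2 (by omega)) hd, ?_⟩
        intro g hg e
        obtain ⟨g, hg', rfl⟩ := List.mem_map.1 hg
        obtain ⟨q, h1, h2, h3⟩ := mem_mergeLayer_exists hg'
        exact next_odd p q (by rw [e]; exact h2) hd
      · rintro ⟨hd, hg⟩
        rcases cases_mod p hd with ⟨q, hq⟩ | ⟨q, hq⟩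
        · exact ⟨q, hq⟩
        · obtain ⟨g, hgm, hgs⟩ := mem_of_odd p q hq
          exact absurd hgs.symm (hg _ (List.mem_map_of_mem hgm))

/-- The layout, filled with the angles of a heap that encodes `x`, is a Clifford loader. -/
lemma loaderLayout_fill {n : ℕ} [NeZero n] (hn2 : 2 ≤ n) {x W f : ℕ → ℝ}
    (h : HeapEncodes n (Nat.clog 2 n) x W f) :
    ((loaderLayout n).fill f).op = jw Finset.univ (fun i : Fin n => x i) ∧
      ImplementsCliffordLoader ((loaderLayout n).fill f) (fun i : Fin n => x i) := by
  have hl := loads_layers h (Nat.le_pow_clog (by norm_num) n)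
    (Nat.pow_pred_clog_lt_self (by norm_num) (by omega)) (Nat.clog 2 n) 0 (by omega)
  have e1 : levelSet n 0 = Finset.univ := by simp [levelSet]
  have e2 : levelCoeff n (Nat.clog 2 n) 0 W = fun i : Fin n => x i := by
    funext p
    simp [levelCoeff, h.leaf p p.2]
  have e3 : (loaderLayout n).fill f = treeCircuit 0 ((List.range' 0 (Nat.clog 2 n)).map fun k =>
      (mergeLayer n (Nat.clog 2 n) k).map (MergePair.map f)) := by
    rw [loaderLayout, dif_pos (by omega : 0 < n), treeCircuit_fill, List.range_eq_range',
      List.map_map]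
    rfl
  rw [e1, e2, ← e3] at hl
  obtain ⟨h1, D, hD, hc⟩ := hl
  exact ⟨h1, D, hD, h1.trans hc.symm⟩

lemma loaderLayout_isParallel (n : ℕ) : (loaderLayout n).IsParallel := by
  rw [loaderLayout]
  split_ifs
  · apply treeCircuit_isParallel
    intro ps hps
    obtain ⟨k, _, rfl⟩ := List.mem_map.1 hps
    exact mergeLayer_pairwise _ _ _
  · simp [Circuit.IsParallel]

lemma loaderLayout_depth (n : ℕ) : (loaderLayout n).depth ≤ 4 * Nat.clog 2 n + 1 := by
  rw [loaderLayout]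
  split_ifs
  · rw [treeCircuit_depth]; simp
  · simp [Circuit.depth]

lemma loaderLayout_size (n : ℕ) : (loaderLayout n).size ≤ 4 * n * Nat.clog 2 n + 1 := by
  rw [loaderLayout]
  split_ifs
  · refine (treeCircuit_size _ _ n ?_).trans ?_
    · intro ps hps
      obtain ⟨k, _, rfl⟩ := List.mem_map.1 hps
      exact mergeLayer_length _ _ _
    · simp
  · simp [Circuit.size]

lemma fill_isParallel {n : ℕ} {α β : Type} {c : Circuit n α} (h : c.IsParallel) (f : α → β) :
    (c.fill f).IsParallel := by
  have hs : ∀ g : Gate n α, (g.map f).support = g.support := by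
    intro g; cases g <;> rfl
  intro l hl
  obtain ⟨l', hl', rfl⟩ := List.mem_map.1 hl
  rw [List.pairwise_map]
  simpa only [hs] using h l' hl'

lemma fill_depth {n : ℕ} {α β : Type} (c : Circuit n α) (f : α → β) :
    (c.fill f).depth = c.depth := by
  simp [Circuit.depth, Circuit.fill]

lemma fill_size {n : ℕ} {α β : Type} (c : Circuit n α) (f : α → β) :
    (c.fill f).size = c.size := by
  simp [Circuit.size, Circuit.fill, Function.comp_def]

/-! ## Amplitudes as determinants -/

/-- The determinant of the rows of `Q` in `T`, and `0` if this is not a square matrix. -/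
noncomputable def detOn {n k : ℕ} (Q : Matrix (Fin n) (Fin k) ℝ) (T : Finset (Fin n)) : ℝ :=
  if h : T.card = k then (Q.submatrix (T.orderEmbOfFin h) id).det else 0

/-- The set of positions of ones. -/
def onesOf {n : ℕ} (b : Bits n) : Finset (Fin n) := Finset.univ.filter fun i => b i = true

lemma onesOf_flip_of_mem {n : ℕ} {b : Bits n} {i : Fin n} (h : i ∈ onesOf b) :
    onesOf (flip b i) = (onesOf b).erase i := by
  ext j
  simp only [onesOf, Finset.mem_filter, Finset.mem_univ, true_and, Finset.mem_erase] at h ⊢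
  by_cases hj : j = i
  · subst hj; simp [h]
  · simp [flip_ne _ hj, hj]

lemma onesOf_flip_of_notMem {n : ℕ} {b : Bits n} {i : Fin n} (h : i ∉ onesOf b) :
    onesOf (flip b i) = insert i (onesOf b) := by
  ext j
  simp only [onesOf, Finset.mem_filter, Finset.mem_univ, true_and, Finset.mem_insert] at h ⊢
  by_cases hj : j = i
  · subst hj; simp [h]
  · simp [flip_ne _ hj, hj]

lemma psign_below_univ {n : ℕ} (b : Bits n) (i : Fin n) :
    psign (below Finset.univ i) b = (((-1) ^ ((onesOf b).filter (· < i)).card : ℝ) : ℂ) := by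
  have : (onesOf b).filter (· < i) = (below Finset.univ i).filter fun j => b j = true := by
    simp only [onesOf, below, Finset.filter_filter, and_comm]
  rw [this, psign]
  simp only [zsign]
  rw [Finset.prod_ite, Finset.prod_const, Finset.prod_const_one, mul_one]
  push_cast
  rfl

lemma orderEmbOfFin_erase {n k : ℕ} {T : Finset (Fin n)} (h : T.card = k + 1) (p : Fin (k + 1))
    (h' : (T.erase (T.orderEmbOfFin h p)).card = k) :
    ((T.erase (T.orderEmbOfFin h p)).orderEmbOfFin h' : Fin k → Fin n) =
      T.orderEmbOfFin h ∘ p.succAbove := by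
  symm
  apply Finset.orderEmbOfFin_unique
  · intro x
    rw [Finset.mem_erase]
    refine ⟨?_, Finset.orderEmbOfFin_mem _ _ _⟩
    intro e
    exact Fin.succAbove_ne p x ((T.orderEmbOfFin h).injective e)
  · exact (T.orderEmbOfFin h).strictMono.comp (Fin.strictMono_succAbove p)

lemma card_filter_lt_orderEmbOfFin {n k : ℕ} {T : Finset (Fin n)} (h : T.card = k) (p : Fin k) :
    (T.filter (· < T.orderEmbOfFin h p)).card = p := by
  have : T.filter (· < T.orderEmbOfFin h p) =
      (Finset.univ.filter (· < p)).map (T.orderEmbOfFin h).toEmbedding := by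
    ext j
    simp only [Finset.mem_filter, Finset.mem_map, Finset.mem_univ, true_and]
    constructor
    · rintro ⟨h1, h2⟩
      have : j ∈ Set.range (T.orderEmbOfFin h) := by rw [Finset.range_orderEmbOfFin]; exact h1
      obtain ⟨q, rfl⟩ := this
      exact ⟨q, (T.orderEmbOfFin h).lt_iff_lt.1 h2, rfl⟩
    · rintro ⟨q, hq, rfl⟩
      exact ⟨Finset.orderEmbOfFin_mem _ _ _, (T.orderEmbOfFin h).lt_iff_lt.2 hq⟩
  rw [this, Finset.card_map]
  have : (Finset.univ.filter (· < p)) = Finset.Iio p := by ext; simp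
  rw [this, Fin.card_Iio]

lemma detOn_erase {n k : ℕ} (Q : Matrix (Fin n) (Fin k) ℝ) {T : Finset (Fin n)}
    (h : T.card = k + 1) (p : Fin (k + 1)) :
    detOn Q (T.erase (T.orderEmbOfFin h p)) =
      (Q.submatrix (T.orderEmbOfFin h ∘ p.succAbove) id).det := by
  have h' : (T.erase (T.orderEmbOfFin h p)).card = k := by
    rw [Finset.card_erase_of_mem (Finset.orderEmbOfFin_mem _ _ _), h]; rfl
  rw [detOn, dif_pos h', orderEmbOfFin_erase h p h']

lemma sum_orderEmbOfFin {n k : ℕ} {T : Finset (Fin n)} (h : T.card = k) (f : Fin n → ℝ) :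
    ∑ i ∈ T, f i = ∑ p, f (T.orderEmbOfFin h p) := by
  have : T = Finset.univ.map (T.orderEmbOfFin h).toEmbedding := by
    apply Finset.coe_injective
    simp
  conv_lhs => rw [this]
  rw [Finset.sum_map]
  rfl

/-- Laplace expansion along the last column. -/
lemma sum_mul_detOn_erase {n k : ℕ} (Q : Matrix (Fin n) (Fin (k + 1)) ℝ) {T : Finset (Fin n)}
    (h : T.card = k + 1) :
    ∑ i ∈ T, Q i (Fin.last k) * (-1) ^ (T.filter (· < i)).card *
      detOn (Q.submatrix id Fin.castSucc) (T.erase i) = (-1) ^ k * detOn Q T := by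
  rw [sum_orderEmbOfFin h, detOn, dif_pos h, Matrix.det_succ_column _ (Fin.last k),
    Finset.mul_sum]
  refine Finset.sum_congr rfl fun p _ => ?_
  rw [card_filter_lt_orderEmbOfFin, detOn_erase]
  have e : ((Q.submatrix (T.orderEmbOfFin h) id).submatrix p.succAbove (Fin.last k).succAbove) =
      (Q.submatrix id Fin.castSucc).submatrix (T.orderEmbOfFin h ∘ p.succAbove) id := by
    ext i j
    simp [Fin.succAbove_last]
  rw [e]
  simp only [Matrix.submatrix_apply, id, Fin.val_last, pow_add]
  have : (-1 : ℝ) ^ k * (-1) ^ k = 1 := by rw [← mul_pow]; simp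
  linear_combination (-(-1 : ℝ) ^ (p : ℕ) * Q (T.orderEmbOfFin h p) (Fin.last k) *
    ((Q.submatrix id Fin.castSucc).submatrix (T.orderEmbOfFin h ∘ p.succAbove) id).det) * this

/-- Laplace expansion along an additional row. -/
lemma detOn_insert {n k : ℕ} (Q : Matrix (Fin n) (Fin (k + 1)) ℝ) {T : Finset (Fin n)}
    (h : T.card = k) {i : Fin n} (hi : i ∉ T) :
    (-1) ^ (T.filter (· < i)).card * detOn Q (insert i T) =
      ∑ c : Fin (k + 1), (-1) ^ (c : ℕ) * Q i c *
        (Q.submatrix (T.orderEmbOfFin h) c.succAbove).det := by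
  have h' : (insert i T).card = k + 1 := by rw [Finset.card_insert_of_notMem hi, h]
  have hm : i ∈ Set.range ((insert i T).orderEmbOfFin h') := by
    rw [Finset.range_orderEmbOfFin]; simp
  obtain ⟨p, hp⟩ := hm
  have hT : (insert i T).erase ((insert i T).orderEmbOfFin h' p) = T := by
    rw [hp, Finset.erase_insert hi]
  have hf : T.filter (· < i) = (insert i T).filter (· < (insert i T).orderEmbOfFin h' p) := by
    rw [hp, Finset.filter_insert, if_neg (lt_irrefl i)]
  have he : (T.orderEmbOfFin h : Fin k → Fin n) =
      (insert i T).orderEmbOfFin h' ∘ p.succAbove := by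
    rw [← orderEmbOfFin_erase h' p (by rw [hT, h])]
    congr!
    exact hT.symm
  rw [hf, card_filter_lt_orderEmbOfFin, detOn, dif_pos h', Matrix.det_succ_row _ p, Finset.mul_sum]
  refine Finset.sum_congr rfl fun c _ => ?_
  rw [Matrix.submatrix_submatrix, he]
  simp only [Matrix.submatrix_apply, id, hp, pow_add, Function.id_comp]
  have : (-1 : ℝ) ^ (p : ℕ) * (-1) ^ (p : ℕ) = 1 := by rw [← mul_pow]; simp
  linear_combination ((-1 : ℝ) ^ (c : ℕ) * Q i c * (Q.submatrix
    ((insert i T).orderEmbOfFin h' ∘ p.succAbove) c.succAbove).det) * this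

/-- The annihilation part of a Clifford loader vanishes by orthogonality. -/
lemma sum_mul_detOn_insert {n k : ℕ} (Q : Matrix (Fin n) (Fin (k + 1)) ℝ) (x : Fin n → ℝ)
    (hx : ∀ c, ∑ i, x i * Q i c = 0) {T : Finset (Fin n)} (h : T.card = k) :
    ∑ i ∈ Tᶜ, x i * (-1) ^ (T.filter (· < i)).card * detOn Q (insert i T) = 0 := by
  set F : Fin n → ℝ := fun i => ∑ c : Fin (k + 1), (-1) ^ (c : ℕ) * Q i c *
        (Q.submatrix (T.orderEmbOfFin h) c.succAbove).det with hF
  -- For `i ∈ T`, `F i` is a determinant with a repeated row. So the sum over the complement of `T`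
  -- extends to all `i`, where it factors into the inner products in `hx`.
  have h0 : ∀ i ∈ T, F i = 0 := by
    intro i hi
    have hm : i ∈ Set.range (T.orderEmbOfFin h) := by rw [Finset.range_orderEmbOfFin]; exact hi
    obtain ⟨p, hp⟩ := hm
    have hd : (Matrix.of (Fin.cons (Q i) fun a => Q (T.orderEmbOfFin h a)) :
        Matrix (Fin (k + 1)) (Fin (k + 1)) ℝ).det = 0 := by
      refine Matrix.det_zero_of_row_eq (i := 0) (j := p.succ) (Fin.succ_ne_zero p).symm ?_
      funext c
      simp [hp]
    rw [Matrix.det_succ_row_zero] at hd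
    exact hd
  have h1 : ∑ i ∈ Tᶜ, x i * (-1) ^ (T.filter (· < i)).card * detOn Q (insert i T) =
      ∑ i, x i * F i := by
    rw [← Finset.sum_add_sum_compl T fun i => x i * F i,
      Finset.sum_eq_zero (s := T) fun i hi => by rw [h0 i hi, mul_zero], zero_add]
    refine Finset.sum_congr rfl fun i hi => ?_
    rw [mul_assoc, detOn_insert Q h (Finset.mem_compl.1 hi)]
  rw [h1]
  simp only [hF, Finset.mul_sum]
  rw [Finset.sum_comm]
  refine Finset.sum_eq_zero fun c _ => ?_
  calc ∑ i, x i * ((-1) ^ (c : ℕ) * Q i c * (Q.submatrix (T.orderEmbOfFin h) c.succAbove).det)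
      = (∑ i, x i * Q i c) *
        ((-1) ^ (c : ℕ) * (Q.submatrix (T.orderEmbOfFin h) c.succAbove).det) := by
        rw [Finset.sum_mul]
        exact Finset.sum_congr rfl fun i _ => by ring
    _ = 0 := by rw [hx, zero_mul]

/-- For an outcome with `k + 1` ones only creation terms survive, and they are the Laplace expansion
along the last column. With `k - 1` ones only annihilation terms remain, and they cancel by
orthogonality. For all other sizes each term is 0 by the default value of `detOn`. -/
lemma jw_mulVec_detOn {n k : ℕ} (Q : Matrix (Fin n) (Fin (k + 1)) ℝ)
    (hQ : ∀ c : Fin k, ∑ i, Q i (Fin.last k) * Q i c.castSucc = 0) :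
    (jw Finset.univ (fun i => Q i (Fin.last k)) *ᵥ
      fun b => (detOn (Q.submatrix id Fin.castSucc) (onesOf b) : ℂ)) =
      fun b => (((-1) ^ k * detOn Q (onesOf b) : ℝ) : ℂ) := by
  funext b
  rw [jw_mulVec]
  simp only [psign_below_univ]
  rw [← Finset.sum_add_sum_compl (onesOf b)]
  rw [Finset.sum_congr (s₁ := onesOf b) rfl fun i hi => by rw [onesOf_flip_of_mem hi],
    Finset.sum_congr (s₁ := (onesOf b)ᶜ) rfl fun i hi => by
      rw [onesOf_flip_of_notMem (Finset.mem_compl.1 hi)]]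
  simp only [← Complex.ofReal_mul, ← Complex.ofReal_sum, ← Complex.ofReal_add]
  rw [Complex.ofReal_inj]
  generalize onesOf b = T
  have hins : T.card ≠ k + 1 → ∀ i ∈ T, detOn (Q.submatrix id Fin.castSucc) (T.erase i) = 0 := by
    intro h i hi
    have := Finset.card_erase_add_one hi
    rw [detOn, dif_neg]
    omega
  by_cases h1 : T.card = k + 1
  · rw [← sum_mul_detOn_erase Q h1, add_eq_left]
    refine Finset.sum_eq_zero fun i hi => ?_
    rw [detOn, dif_neg, mul_zero]
    rw [Finset.card_insert_of_notMem (Finset.mem_compl.1 hi)]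
    omega
  · rw [Finset.sum_eq_zero fun i hi => by rw [hins h1 i hi, mul_zero], zero_add]
    have hr : detOn Q T = 0 := by rw [detOn, dif_neg h1]
    rw [hr, mul_zero]
    cases k with
    | zero =>
      refine Finset.sum_eq_zero fun i hi => ?_
      rw [detOn, dif_neg, mul_zero]
      rw [Finset.card_insert_of_notMem (Finset.mem_compl.1 hi)]
      omega
    | succ k =>
      by_cases h2 : T.card = k
      · exact sum_mul_detOn_insert _ _ hQ h2
      · refine Finset.sum_eq_zero fun i hi => ?_
        rw [detOn, dif_neg, mul_zero]
        rw [Finset.card_insert_of_notMem (Finset.mem_compl.1 hi)]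
        omega

/-- Start from the empty determinant, which is 1 on the zero string, and add one column at a time.
The global sign collects the factors `(-1) ^ k` and disappears in the probabilities. -/
lemma seqOp_jw_mulVec {n : ℕ} (d : ℕ) : ∀ Q : Matrix (Fin n) (Fin d) ℝ, Qᵀ * Q = 1 →
    ∃ s : ℝ, s ^ 2 = 1 ∧
      seqOp ((List.finRange d).map fun j => jw Finset.univ fun i => Q i j) *ᵥ
        ket (fun _ => false) = fun b => ((s * detOn Q (onesOf b) : ℝ) : ℂ) := by
  induction d with
  | zero =>
    intro Q _
    refine ⟨1, by norm_num, ?_⟩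
    funext b
    simp only [List.finRange_zero, List.map_nil, seqOp, Matrix.one_mulVec, ket, Pi.single_apply,
      detOn, one_mul]
    by_cases hb : b = fun _ => false
    · subst hb
      simp [onesOf]
    · rw [if_neg hb, dif_neg]
      · simp
      · intro h
        apply hb
        funext i
        rw [Finset.card_eq_zero, onesOf, Finset.filter_eq_empty_iff] at h
        simpa using h (Finset.mem_univ i)
  | succ k ih =>
    intro Q hQ
    have hQe : ∀ a c, ∑ i, Q i a * Q i c = if a = c then 1 else 0 := by
      intro a c
      have := congrFun (congrFun hQ a) c
      rw [Matrix.mul_apply, Matrix.one_apply] at this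
      simpa using this
    obtain ⟨s, hs, h⟩ := ih (Q.submatrix id Fin.castSucc) (by
      ext a c
      rw [Matrix.mul_apply, Matrix.one_apply]
      simpa using hQe a.castSucc c.castSucc)
    refine ⟨s * (-1) ^ k, by rw [mul_pow, hs, ← pow_mul, mul_comm k, pow_mul]; simp, ?_⟩
    rw [List.finRange_succ_last, List.map_append, seqOp_append, ← Matrix.mulVec_mulVec,
      List.map_map]
    simp only [Matrix.submatrix_apply, id] at h
    simp only [Function.comp_def]
    rw [h]
    simp only [List.map_cons, List.map_nil, seqOp, one_mul]
    have e : (fun b => ((s * detOn (Q.submatrix id Fin.castSucc) (onesOf b) : ℝ) : ℂ)) =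
        (s : ℂ) • fun b => ((detOn (Q.submatrix id Fin.castSucc) (onesOf b) : ℝ) : ℂ) := by
      funext b; simp
    rw [e, Matrix.mulVec_smul, jw_mulVec_detOn Q]
    · funext b
      simp [mul_assoc]
    · intro c
      rw [hQe, if_neg]
      exact (Fin.castSucc_lt_last c).ne'

/-! ### From an orthonormal basis to the determinant distribution -/

lemma eq_zero_of_mulVec_eq_zero_of_rank {n d : ℕ} {A : Matrix (Fin n) (Fin d) ℝ} (hA : A.rank = d)
    {v : Fin d → ℝ} (hv : A *ᵥ v = 0) : v = 0 := by
  have h := LinearMap.finrank_range_add_finrank_ker A.mulVecLin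
  rw [← Matrix.rank, hA, Module.finrank_fin_fun, Nat.add_eq_left, Submodule.finrank_eq_zero] at h
  have : v ∈ LinearMap.ker A.mulVecLin := hv
  rwa [h] at this

/-- An orthonormal basis of the column space yields the determinant distribution. -/
lemma detOn_sq_eq_detDist {n d : ℕ} (A Q : Matrix (Fin n) (Fin d) ℝ) (hQ : Qᵀ * Q = 1)
    (hA : A.rank = d) (hr : LinearMap.range A.mulVecLin ≤ LinearMap.range Q.mulVecLin)
    (S : Finset (Fin n)) : detOn Q S ^ 2 = detDist A S := by
  -- `Q * Qᵀ` fixes the column space of `Q`, which contains the columns of `A`.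
  have hfac : A = Q * (Qᵀ * A) := by
    apply Matrix.ext_of_mulVec_single
    intro j
    obtain ⟨y, hy⟩ := hr ⟨Pi.single j 1, rfl⟩
    simp only [Matrix.mulVecLin_apply] at hy
    rw [← Matrix.mulVec_mulVec, ← Matrix.mulVec_mulVec, ← hy, Matrix.mulVec_mulVec y Qᵀ Q, hQ,
      Matrix.one_mulVec]
  set R := Qᵀ * A with hR
  have hdet : (Aᵀ * A).det = R.det ^ 2 := by
    rw [hfac, Matrix.transpose_mul, Matrix.mul_assoc, ← Matrix.mul_assoc Qᵀ, hQ, Matrix.one_mul,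
      Matrix.det_mul, Matrix.det_transpose, sq]
  have hne : R.det ≠ 0 := by
    intro h0
    obtain ⟨v, hv, hv'⟩ := Matrix.exists_mulVec_eq_zero_iff.2 h0
    refine hv (eq_zero_of_mulVec_eq_zero_of_rank hA ?_)
    rw [hfac, ← Matrix.mulVec_mulVec, hv', Matrix.mulVec_zero]
  rw [detOn, detDist]
  split_ifs with h
  · rw [hdet, eq_div_iff (pow_ne_zero 2 hne)]
    conv_rhs => rw [hfac]
    rw [Matrix.submatrix_mul _ _ _ id _ Function.bijective_id, Matrix.det_mul, mul_pow]
    simp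
  · simp

lemma op_flatMap {n d : ℕ} (loader : Fin d → Circuit n ℝ) :
    Circuit.op ((List.finRange d).flatMap loader) =
      seqOp ((List.finRange d).map fun j => (loader j).op) := by
  induction List.finRange d with
  | nil => simp [Circuit.op, seqOp]
  | cons j l ih =>
    simp only [Circuit.op] at ih ⊢
    rw [List.flatMap_cons, List.flatten_append, List.map_append, seqOp_append, ih, List.map_cons,
      seqOp]

lemma onesOf_bitsOf {n : ℕ} (S : Finset (Fin n)) : onesOf (bitsOf S) = S := by
  ext i; simp [onesOf, bitsOf]

/-! ## Execution of programs -/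

@[simp] lemma Mem.setReg_reg (m : Mem) (r v q : ℕ) :
    (m.setReg r v).reg q = if q = r then v else m.reg q := by
  simp [Mem.setReg, Function.update_apply]

@[simp] lemma Mem.setReg_arr (m : Mem) (r v : ℕ) : (m.setReg r v).arr = m.arr := rfl

@[simp] lemma Mem.setArr_reg (m : Mem) (a i j : ℕ) (v : ℝ) : (m.setArr a i j v).reg = m.reg := rfl

lemma Mem.setArr_arr (m : Mem) (a i j : ℕ) (v : ℝ) (b k l : ℕ) :
    (m.setArr a i j v).arr b k l = if b = a ∧ k = i ∧ l = j then v else m.arr b k l := by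
  by_cases hb : b = a <;> by_cases hk : k = i <;> by_cases hl : l = j <;>
    simp [Mem.setArr, hb, hk, hl]

lemma Mem.setArr_arr_ne (m : Mem) {a b : ℕ} (h : b ≠ a) (i j : ℕ) (v : ℝ) :
    (m.setArr a i j v).arr b = m.arr b := by
  simp [Mem.setArr, h]

/-- The registers that a program may change. -/
def Prog.regs : Prog → Finset ℕ
  | .setReg r _ => {r}
  | .setArr _ _ _ _ => ∅
  | .seq p q => p.regs ∪ q.regs
  | .ite _ p q => p.regs ∪ q.regs
  | .loop r _ p => insert r p.regs

/-- The arrays that a program may change. -/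
def Prog.arrs : Prog → Finset ℕ
  | .setReg _ _ => ∅
  | .setArr a _ _ _ => {a}
  | .seq p q => p.arrs ∪ q.arrs
  | .ite _ p q => p.arrs ∪ q.arrs
  | .loop _ _ p => p.arrs

lemma loopState_induction {r : ℕ} {f : Mem → Mem} {m : Mem} (I : ℕ → Mem → Prop) (K : ℕ)
    (h0 : I 0 m) (hs : ∀ k < K, ∀ m', I k m' → I (k + 1) (f (m'.setReg r k))) :
    I K (loopState r f m K) := by
  induction K with
  | zero => exact h0
  | succ K ih => exact hs K (by omega) _ (ih fun k hk => hs k (by omega))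

/-- A syntactic frame rule. With its analogue for arrays it spares the loop invariants from listing
what a subprogram leaves alone. -/
lemma Prog.exec_reg (p : Prog) {q : ℕ} : ∀ m : Mem, q ∉ p.regs → (p.exec m).reg q = m.reg q := by
  induction p with
  | setReg r e => intro m h; simp_all [Prog.regs, Prog.exec]
  | setArr a i j e => intro m _; simp [Prog.exec]
  | seq p p' ih ih' =>
    intro m h
    rw [Prog.regs, Finset.mem_union, not_or] at h
    rw [Prog.exec, ih' _ h.2, ih _ h.1]
  | ite t p p' ih ih' =>
    intro m h
    rw [Prog.regs, Finset.mem_union, not_or] at h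
    rw [Prog.exec]
    split_ifs
    · exact ih _ h.1
    · exact ih' _ h.2
  | loop r e p ih =>
    intro m h
    rw [Prog.regs, Finset.mem_insert, not_or] at h
    rw [Prog.exec]
    refine loopState_induction (fun _ m' => m'.reg q = m.reg q) _ rfl fun k _ m' hm' => ?_
    rw [ih _ h.2, Mem.setReg_reg, if_neg h.1, hm']

lemma Prog.exec_arr (p : Prog) {a : ℕ} : ∀ m : Mem, a ∉ p.arrs → (p.exec m).arr a = m.arr a := by
  induction p with
  | setReg r e => intro m _; simp [Prog.exec]
  | setArr b i j e =>
    intro m h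
    exact Mem.setArr_arr_ne _ (by simpa [Prog.arrs] using h) _ _ _
  | seq p p' ih ih' =>
    intro m h
    rw [Prog.arrs, Finset.mem_union, not_or] at h
    rw [Prog.exec, ih' _ h.2, ih _ h.1]
  | ite t p p' ih ih' =>
    intro m h
    rw [Prog.arrs, Finset.mem_union, not_or] at h
    rw [Prog.exec]
    split_ifs
    · exact ih _ h.1
    · exact ih' _ h.2
  | loop r e p ih =>
    intro m h
    rw [Prog.exec]
    refine loopState_induction (fun _ m' => m'.arr a = m.arr a) _ rfl fun k _ m' hm' => ?_
    rw [ih _ h, Mem.setReg_arr, hm']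

/-- The state after `k` rounds of a loop satisfies the invariant. -/
lemma loop_time_le {r : ℕ} {e : IExpr} {p : Prog} {m : Mem} (I : ℕ → Mem → Prop) (t : ℕ)
    (h0 : I 0 m) (hs : ∀ k < e.eval m, ∀ m', I k m' → p.time (m'.setReg r k) ≤ t ∧
      I (k + 1) (p.exec (m'.setReg r k))) :
    (Prog.loop r e p).time m ≤ e.time + 1 + e.eval m * (t + 1) ∧
      I (e.eval m) ((Prog.loop r e p).exec m) := by
  have hI : ∀ k ≤ e.eval m, I k (loopState r p.exec m k) := fun k hk =>
    loopState_induction I k h0 fun k' hk' m' hm' => (hs k' (by omega) m' hm').2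
  refine ⟨?_, hI _ le_rfl⟩
  rw [Prog.time]
  gcongr
  have := Finset.sum_le_card_nsmul (Finset.range (e.eval m))
    (fun k => p.time ((loopState r p.exec m k).setReg r k) + 1) (t + 1) (by
      intro k hk
      have hk' := Finset.mem_range.1 hk
      have := (hs k hk' _ (hI k hk'.le)).1
      omega)
  simpa using this

/-- A loop whose body takes at most `t` steps in every state. -/
lemma loop_time_le_of_forall {r : ℕ} {e : IExpr} {p : Prog} {m : Mem} (t : ℕ)
    (h : ∀ m', p.time m' ≤ t) :
    (Prog.loop r e p).time m ≤ e.time + 1 + e.eval m * (t + 1) :=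
  (loop_time_le (fun _ _ => True) t trivial fun _ _ _ _ => ⟨h _, trivial⟩).1

/-! ### The size of the heap -/

/-- All loops are bounded, so a conditional doubling is repeated `n` times, which is enough as
`Nat.clog 2 n ≤ n`. Register 2 keeps the number of leaves; registers 3, 4, 5 and 6 will hold the
current column, an earlier column, the row and the heap node. Arrays 3 and 4 will hold the heap and
an accumulator. -/
def heapSizeProg : Prog :=
  .seq (.setReg 2 (.lit 1)) (.loop 7 (.reg 0)
    (.ite (.ilt (.reg 2) (.reg 0)) (.setReg 2 (.add (.reg 2) (.reg 2))) (.setReg 2 (.reg 2))))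

lemma clog_le_self (n : ℕ) : Nat.clog 2 n ≤ n :=
  Nat.clog_le_of_le_pow Nat.lt_two_pow_self.le

lemma heapSizeProg_exec (m : Mem) : (heapSizeProg.exec m).reg 2 = 2 ^ Nat.clog 2 (m.reg 0) := by
  have h := loopState_induction (r := 7) (f := (Prog.ite (.ilt (.reg 2) (.reg 0))
    (.setReg 2 (.add (.reg 2) (.reg 2))) (.setReg 2 (.reg 2))).exec) (m := m.setReg 2 1)
    (fun k m' => m'.reg 0 = m.reg 0 ∧ m'.reg 2 = 2 ^ min k (Nat.clog 2 (m.reg 0))) (m.reg 0)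
    (by simp) (by
      rintro k hk m' ⟨h0, h2⟩
      have hlt := Nat.lt_clog_iff_pow_lt (b := 2) (by norm_num) (x := m.reg 0)
        (y := min k (Nat.clog 2 (m.reg 0)))
      simp only [Prog.exec, Test.holds, IExpr.eval, Mem.setReg_reg]
      norm_num
      rw [h0, h2]
      split_ifs with h <;> rw [← hlt] at h
      · refine ⟨by simp [h0], ?_⟩
        have : min (k + 1) (Nat.clog 2 (m.reg 0)) = min k (Nat.clog 2 (m.reg 0)) + 1 := by omega
        rw [this, pow_succ]
        simp
        omega
      · refine ⟨by simp [h0], ?_⟩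
        have : min (k + 1) (Nat.clog 2 (m.reg 0)) = min k (Nat.clog 2 (m.reg 0)) := by omega
        rw [this]
        simp)
  have h2 := h.2
  rw [min_eq_right (clog_le_self _)] at h2
  simpa [heapSizeProg, Prog.exec, IExpr.eval] using h2

lemma heapSizeProg_time (m : Mem) : heapSizeProg.time m ≤ 20 + 20 * m.reg 0 := by
  have h := loop_time_le_of_forall (r := 7) (e := .reg 0) (m := m.setReg 2 1)
    (p := .ite (.ilt (.reg 2) (.reg 0)) (.setReg 2 (.add (.reg 2) (.reg 2))) (.setReg 2 (.reg 2)))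
    10 (by
      intro m'
      simp only [Prog.time, Test.time, IExpr.time]
      split_ifs <;> norm_num)
  have e : heapSizeProg.time m = 2 + (Prog.loop 7 (.reg 0) (.ite (.ilt (.reg 2) (.reg 0))
    (.setReg 2 (.add (.reg 2) (.reg 2))) (.setReg 2 (.reg 2)))).time (m.setReg 2 1) := rfl
  have e' : (IExpr.reg 0).eval (m.setReg 2 1) = m.reg 0 := by simp [IExpr.eval]
  rw [e'] at h
  simp only [IExpr.time] at h
  omega

/-! ### Column operations -/

/-- Assign the value of `e` to all entries of the current column of array `1`. -/
def colProg (e : RExpr) : Prog := .loop 5 (.reg 0) (.setArr 1 (.reg 5) (.reg 3) e)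

/-- In round `k` the rows from `k` on are still untouched, so `e` may read the entry that it is
about to overwrite. -/
lemma colProg_exec (e : RExpr) (m : Mem) (g : ℕ → ℝ)
    (h : ∀ k < m.reg 0, ∀ m' : Mem, (∀ q, q ≠ 5 → m'.reg q = m.reg q) → m'.reg 5 = k →
      (∀ a, a ≠ 1 → m'.arr a = m.arr a) →
      (∀ r c, c ≠ m.reg 3 ∨ k ≤ r → m'.arr 1 r c = m.arr 1 r c) → e.eval m' = g k) (r c : ℕ) :
    ((colProg e).exec m).arr 1 r c =
      if c = m.reg 3 ∧ r < m.reg 0 then g r else m.arr 1 r c := by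
  have key := loopState_induction (r := 5) (f := (Prog.setArr 1 (.reg 5) (.reg 3) e).exec) (m := m)
    (fun k m' => (∀ q, q ≠ 5 → m'.reg q = m.reg q) ∧ (∀ a, a ≠ 1 → m'.arr a = m.arr a) ∧
      ∀ r c, m'.arr 1 r c = if c = m.reg 3 ∧ r < k then g r else m.arr 1 r c) (m.reg 0)
    (by simp) (by
      rintro k hk m' ⟨h1, h2, h3⟩
      refine ⟨?_, ?_, ?_⟩
      · intro q hq
        simp [Prog.exec, hq, h1 q hq]
      · intro a ha
        rw [Prog.exec, Mem.setArr_arr_ne _ ha, Mem.setReg_arr, h2 a ha]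
      · intro r c
        have he := h k hk (m'.setReg 5 k) (fun q hq => by simp [hq, h1 q hq]) (by simp)
          (fun a ha => by simp [h2 a ha]) (fun r c hrc => by
            rw [Mem.setReg_arr, h3, if_neg]
            omega)
        simp only [Prog.exec, Mem.setArr_arr, he, IExpr.eval, Mem.setReg_reg, Mem.setReg_arr, h3,
          h1 3 (by norm_num)]
        by_cases hc : c = m.reg 3
        · rcases lt_trichotomy r k with hr | hr | hr
          · simp [hc, hr, hr.ne, hr.le]
          · simp [hc, hr]
          · simp [hc, hr.ne', hr.not_gt, hr.not_ge]
        · simp [hc])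
  exact key.2.2 r c

lemma colProg_time (e : RExpr) (m : Mem) :
    (colProg e).time m ≤ 2 + m.reg 0 * (e.time + 4) := by
  have h := loop_time_le_of_forall (r := 5) (e := .reg 0) (m := m)
    (p := .setArr 1 (.reg 5) (.reg 3) e) (e.time + 3) (by
      intro m'
      simp only [Prog.time, IExpr.time]
      omega)
  simpa [colProg, IExpr.time, IExpr.eval] using h

/-- The accumulator. -/
def accExpr : RExpr := .get 4 (.lit 0) (.lit 0)

/-- Compute the sum of the values of `e` over all rows. -/
def sumProg (e : RExpr) : Prog :=
  .seq (.setArr 4 (.lit 0) (.lit 0) (.lit 0))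
    (.loop 5 (.reg 0) (.setArr 4 (.lit 0) (.lit 0) (.add accExpr e)))

lemma sumProg_exec (e : RExpr) (m : Mem) (g : ℕ → ℝ)
    (h : ∀ k < m.reg 0, ∀ m' : Mem, (∀ q, q ≠ 5 → m'.reg q = m.reg q) → m'.reg 5 = k →
      (∀ a, a ≠ 4 → m'.arr a = m.arr a) → e.eval m' = g k) :
    ((sumProg e).exec m).arr 4 0 0 = ∑ k ∈ Finset.range (m.reg 0), g k := by
  have key := loopState_induction (r := 5)
    (f := (Prog.setArr 4 (.lit 0) (.lit 0) (.add accExpr e)).exec) (m := m.setArr 4 0 0 0)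
    (fun k m' => (∀ q, q ≠ 5 → m'.reg q = m.reg q) ∧ (∀ a, a ≠ 4 → m'.arr a = m.arr a) ∧
      m'.arr 4 0 0 = ∑ k ∈ Finset.range k, g k) (m.reg 0)
    (by
      refine ⟨by simp, fun a ha => Mem.setArr_arr_ne _ ha _ _ _, by simp [Mem.setArr_arr]⟩) (by
      rintro k hk m' ⟨h1, h2, h3⟩
      refine ⟨?_, ?_, ?_⟩
      · intro q hq
        simp [Prog.exec, hq, h1 q hq]
      · intro a ha
        rw [Prog.exec, Mem.setArr_arr_ne _ ha, Mem.setReg_arr, h2 a ha]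
      · have he := h k hk (m'.setReg 5 k) (fun q hq => by simp [hq, h1 q hq]) (by simp)
          (fun a ha => by simp [h2 a ha])
        simp [Prog.exec, Mem.setArr_arr, IExpr.eval, RExpr.eval, accExpr, he, h3,
          Finset.sum_range_succ])
  simpa [sumProg, Prog.exec, IExpr.eval, RExpr.eval] using key.2.2

lemma sumProg_time (e : RExpr) (m : Mem) :
    (sumProg e).time m ≤ 6 + m.reg 0 * (e.time + 8) := by
  have h := loop_time_le_of_forall (r := 5) (e := .reg 0) (m := m.setArr 4 0 0 0)
    (p := .setArr 4 (.lit 0) (.lit 0) (.add accExpr e)) (e.time + 7) (by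
      intro m'
      simp only [Prog.time, IExpr.time, RExpr.time, accExpr]
      omega)
  have e1 : (sumProg e).time m = 4 + (Prog.loop 5 (.reg 0)
      (.setArr 4 (.lit 0) (.lit 0) (.add accExpr e))).time (m.setArr 4 0 0 0) := by
    simp [sumProg, Prog.time.eq_3, Prog.time.eq_2, Prog.exec, IExpr.time, IExpr.eval, RExpr.time,
      RExpr.eval]
  have e2 : (IExpr.reg 0).eval (m.setArr 4 0 0 0) = m.reg 0 := rfl
  rw [e2, show e.time + 7 + 1 = e.time + 8 from rfl] at h
  simp only [IExpr.time] at h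
  omega

/-! ### Gram–Schmidt -/

/-- Subtract from the current column its projection to the column `reg 4`. -/
def projProg : Prog :=
  .seq (sumProg (.mul (.get 1 (.reg 5) (.reg 4)) (.get 0 (.reg 5) (.reg 3))))
    (colProg (.sub (.get 1 (.reg 5) (.reg 3)) (.mul accExpr (.get 1 (.reg 5) (.reg 4)))))

/-- The coefficient is taken with the original column in array 0, not with the partly reduced one
(classical, not modified, Gram–Schmidt). Hence repeated subtraction gives the closed form
`residual`. -/
lemma projProg_exec (m : Mem) (h : m.reg 4 ≠ m.reg 3) (r c : ℕ) :
    (projProg.exec m).arr 1 r c = if c = m.reg 3 ∧ r < m.reg 0 then m.arr 1 r (m.reg 3) -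
      (∑ k ∈ Finset.range (m.reg 0), m.arr 1 k (m.reg 4) * m.arr 0 k (m.reg 3)) *
        m.arr 1 r (m.reg 4) else m.arr 1 r c := by
  rw [projProg, Prog.exec]
  set m1 := (sumProg (.mul (.get 1 (.reg 5) (.reg 4)) (.get 0 (.reg 5) (.reg 3)))).exec m with hm1
  have hreg : ∀ q, q ≠ 5 → m1.reg q = m.reg q := fun q hq =>
    Prog.exec_reg _ _ (by simpa [sumProg, Prog.regs] using hq)
  have harr : ∀ a, a ≠ 4 → m1.arr a = m.arr a := fun a ha =>
    Prog.exec_arr _ _ (by simpa [sumProg, Prog.arrs] using ha)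
  have hacc : m1.arr 4 0 0 =
      ∑ k ∈ Finset.range (m.reg 0), m.arr 1 k (m.reg 4) * m.arr 0 k (m.reg 3) := by
    apply sumProg_exec
    intro k _ m' h1 h2 h3
    simp [RExpr.eval, IExpr.eval, h1, h2, h3]
  rw [colProg_exec _ m1 (fun r => m.arr 1 r (m.reg 3) -
      (∑ k ∈ Finset.range (m.reg 0), m.arr 1 k (m.reg 4) * m.arr 0 k (m.reg 3)) *
        m.arr 1 r (m.reg 4)), hreg 3 (by norm_num), hreg 0 (by norm_num), harr 1 (by norm_num)]
  intro k _ m' h1 h2 h3 h4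
  rw [hreg 3 (by norm_num), harr 1 (by norm_num)] at h4
  simp only [RExpr.eval, IExpr.eval, accExpr, h2, h3 4 (by norm_num), h1 3 (by norm_num),
    h1 4 (by norm_num), hreg 3 (by norm_num), hreg 4 (by norm_num), hacc]
  rw [h4 k _ (Or.inr le_rfl), h4 k _ (Or.inl h)]

lemma projProg_time (m : Mem) : projProg.time m ≤ 8 + m.reg 0 * 32 := by
  rw [projProg, Prog.time]
  have h1 := sumProg_time (.mul (.get 1 (.reg 5) (.reg 4)) (.get 0 (.reg 5) (.reg 3))) m
  have h2 := colProg_time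
    (.sub (.get 1 (.reg 5) (.reg 3)) (.mul accExpr (.get 1 (.reg 5) (.reg 4))))
    ((sumProg (.mul (.get 1 (.reg 5) (.reg 4)) (.get 0 (.reg 5) (.reg 3)))).exec m)
  rw [Prog.exec_reg _ _ (by simp [sumProg, Prog.regs])] at h2
  have ha : accExpr.time = 3 := rfl
  simp only [RExpr.time, IExpr.time, ha] at h1 h2
  omega

/-- The component of column `j` of `a` that is orthogonal to the columns `i < j` of `q`. -/
noncomputable def residual (n : ℕ) (a q : ℕ → ℕ → ℝ) (j r : ℕ) : ℝ :=
  a r j - ∑ i ∈ Finset.range j, (∑ k ∈ Finset.range n, q k i * a k j) * q r i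

/-- One step of the Gram–Schmidt process for the current column. -/
def gramSchmidtProg : Prog :=
  .seq (colProg (.get 0 (.reg 5) (.reg 3)))
    (.seq (.loop 4 (.reg 3) projProg)
      (.seq (sumProg (.mul (.get 1 (.reg 5) (.reg 3)) (.get 1 (.reg 5) (.reg 3))))
        (colProg (.div (.get 1 (.reg 5) (.reg 3)) (.sqrt accExpr)))))

/-- A pure formula, valid even when the norm is 0; that the norm is positive is shown in
`gramSchmidt_orthonormal`. -/
lemma gramSchmidtProg_exec (m : Mem) (r c : ℕ) :
    (gramSchmidtProg.exec m).arr 1 r c = if c = m.reg 3 ∧ r < m.reg 0 then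
      residual (m.reg 0) (m.arr 0) (m.arr 1) (m.reg 3) r /
        √(∑ k ∈ Finset.range (m.reg 0), residual (m.reg 0) (m.arr 0) (m.arr 1) (m.reg 3) k ^ 2)
      else m.arr 1 r c := by
  simp only [gramSchmidtProg, Prog.exec]
  set m1 := (colProg (.get 0 (.reg 5) (.reg 3))).exec m with hm1
  have hreg1 : ∀ q, q ≠ 5 → m1.reg q = m.reg q := fun q hq =>
    Prog.exec_reg _ _ (by simpa [colProg, Prog.regs] using hq)
  have harr1 : ∀ a, a ≠ 1 → m1.arr a = m.arr a := fun a ha =>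
    Prog.exec_arr _ _ (by simpa [colProg, Prog.arrs] using ha)
  have h1 : ∀ r c, m1.arr 1 r c =
      if c = m.reg 3 ∧ r < m.reg 0 then m.arr 0 r (m.reg 3) else m.arr 1 r c := by
    refine colProg_exec _ _ _ ?_
    intro k _ m' h1 h2 h3 _
    simp [RExpr.eval, IExpr.eval, h1, h2, h3]
  set m2 := loopState 4 projProg.exec m1 ((IExpr.reg 3).eval m1) with hm2
  have h2 := loopState_induction (r := 4) (f := projProg.exec) (m := m1)
    (fun i m' => (∀ q, q ≠ 4 → q ≠ 5 → m'.reg q = m.reg q) ∧ m'.arr 0 = m.arr 0 ∧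
      ∀ r c, m'.arr 1 r c = if c = m.reg 3 ∧ r < m.reg 0 then m.arr 0 r (m.reg 3) -
        ∑ i' ∈ Finset.range i, (∑ k ∈ Finset.range (m.reg 0), m.arr 1 k i' * m.arr 0 k (m.reg 3)) *
          m.arr 1 r i' else m.arr 1 r c) ((IExpr.reg 3).eval m1)
    (by
      refine ⟨fun q _ hq => hreg1 q hq, harr1 0 (by norm_num), ?_⟩
      simpa using h1) (by
      rintro i hi m' ⟨k1, k2, k3⟩
      have hi' : i < m.reg 3 := by simpa [IExpr.eval, hreg1] using hi
      refine ⟨?_, ?_, ?_⟩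
      · intro q hq4 hq5
        rw [Prog.exec_reg _ _ (by simpa [projProg, sumProg, colProg, Prog.regs] using hq5)]
        simp [hq4, k1 q hq4 hq5]
      · rw [Prog.exec_arr _ _ (by simp [projProg, sumProg, colProg, Prog.arrs]), Mem.setReg_arr, k2]
      · intro r c
        rw [projProg_exec]
        · simp only [Mem.setReg_reg, Mem.setReg_arr, k2, k1 0 (by norm_num) (by norm_num),
            k1 3 (by norm_num) (by norm_num), if_true]
          norm_num
          by_cases hrc : c = m.reg 3 ∧ r < m.reg 0
          · have hki : ∀ k, m'.arr 1 k i = m.arr 1 k i := fun k => by rw [k3, if_neg (by omega)]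
            rw [if_pos hrc, if_pos hrc, Finset.sum_range_succ, k3, if_pos ⟨rfl, hrc.2⟩]
            simp only [hki]
            ring
          · rw [if_neg hrc, if_neg hrc, k3, if_neg hrc]
        · simp [k1 3]
          omega)
  rw [← hm2] at h2
  obtain ⟨k1, k2, k3⟩ := h2
  have he : (IExpr.reg 3).eval m1 = m.reg 3 := by simp [IExpr.eval, hreg1]
  rw [he] at k3
  have k3' : ∀ r < m.reg 0, m2.arr 1 r (m.reg 3) =
      residual (m.reg 0) (m.arr 0) (m.arr 1) (m.reg 3) r := by
    intro r hr
    rw [k3, if_pos ⟨rfl, hr⟩, residual]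
  set m3 := (sumProg (.mul (.get 1 (.reg 5) (.reg 3)) (.get 1 (.reg 5) (.reg 3)))).exec m2 with hm3
  have hreg3 : ∀ q, q ≠ 5 → m3.reg q = m2.reg q := fun q hq =>
    Prog.exec_reg _ _ (by simpa [sumProg, Prog.regs] using hq)
  have harr3 : m3.arr 1 = m2.arr 1 := Prog.exec_arr _ _ (by simp [sumProg, Prog.arrs])
  have r0 := k1 0 (by norm_num) (by norm_num)
  have r3 := k1 3 (by norm_num) (by norm_num)
  have hacc : m3.arr 4 0 0 = ∑ k ∈ Finset.range (m.reg 0),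
      residual (m.reg 0) (m.arr 0) (m.arr 1) (m.reg 3) k ^ 2 := by
    rw [hm3, sumProg_exec _ _ fun k => residual (m.reg 0) (m.arr 0) (m.arr 1) (m.reg 3) k ^ 2, r0]
    intro k hk m' h1 h2 h3
    rw [r0] at hk
    simp [RExpr.eval, IExpr.eval, h1, h2, h3, r3, k3' k hk, sq]
  rw [colProg_exec _ m3 fun r => residual (m.reg 0) (m.arr 0) (m.arr 1) (m.reg 3) r /
        √(∑ k ∈ Finset.range (m.reg 0), residual (m.reg 0) (m.arr 0) (m.arr 1) (m.reg 3) k ^ 2)]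
  · rw [hreg3 3 (by norm_num), hreg3 0 (by norm_num), r0, r3, harr3, k3]
    by_cases hrc : c = m.reg 3 ∧ r < m.reg 0
    · rw [if_pos hrc, if_pos hrc]
    · rw [if_neg hrc, if_neg hrc, if_neg hrc]
  · intro k hk m' h1 h2 h3 h4
    rw [hreg3 0 (by norm_num), r0] at hk
    simp only [RExpr.eval, IExpr.eval, accExpr, h2, h3 4 (by norm_num), h1 3 (by norm_num), hacc,
      hreg3 3 (by norm_num), r3]
    rw [h4 k _ (Or.inr le_rfl), harr3, k3' k hk]

lemma gramSchmidtProg_time (m : Mem) :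
    gramSchmidtProg.time m ≤ 20 + m.reg 0 * 50 + m.reg 3 * (9 + m.reg 0 * 32) := by
  rw [gramSchmidtProg]
  have t1 := colProg_time (.get 0 (.reg 5) (.reg 3)) m
  set m1 := (colProg (.get 0 (.reg 5) (.reg 3))).exec m with hm1
  have hreg1 : ∀ q, q ≠ 5 → m1.reg q = m.reg q := fun q hq =>
    Prog.exec_reg _ _ (by simpa [colProg, Prog.regs] using hq)
  have t2 := (loop_time_le (r := 4) (e := .reg 3) (p := projProg) (m := m1)
    (fun _ m' => m'.reg 0 = m.reg 0) (8 + m.reg 0 * 32) (hreg1 0 (by norm_num)) (by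
      intro k _ m' hm'
      refine ⟨(projProg_time _).trans (by simp [hm']), ?_⟩
      rw [Prog.exec_reg _ _ (by simp [projProg, sumProg, colProg, Prog.regs])]
      simp [hm'])).1
  set m2 := (Prog.loop 4 (.reg 3) projProg).exec m1 with hm2
  have hreg2 : m2.reg 0 = m.reg 0 := by
    rw [hm2, Prog.exec_reg _ _ (by simp [projProg, sumProg, colProg, Prog.regs]),
      hreg1 0 (by norm_num)]
  have t3 := sumProg_time (.mul (.get 1 (.reg 5) (.reg 3)) (.get 1 (.reg 5) (.reg 3))) m2
  set m3 := (sumProg (.mul (.get 1 (.reg 5) (.reg 3)) (.get 1 (.reg 5) (.reg 3)))).exec m2 with hm3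
  have hreg3 : m3.reg 0 = m.reg 0 := by
    rw [hm3, Prog.exec_reg _ _ (by simp [sumProg, Prog.regs]), hreg2]
  have t4 := colProg_time (.div (.get 1 (.reg 5) (.reg 3)) (.sqrt accExpr)) m3
  have ha : accExpr.time = 3 := rfl
  rw [hreg2] at t3
  rw [hreg3] at t4
  simp only [RExpr.time, IExpr.time, IExpr.eval, ha, hreg1 3 (by norm_num)] at t1 t2 t3 t4
  rw [Prog.time.eq_3, Prog.time.eq_3, Prog.time.eq_3, ← hm1, ← hm2, ← hm3]
  rw [show 8 + m.reg 0 * 32 + 1 = 9 + m.reg 0 * 32 by ring] at t2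
  omega

/-! ### Angles -/

/-- Write the current column of array `1` into the leaves of the heap. -/
def leafProg : Prog :=
  .loop 5 (.reg 0) (.setArr 3 (.lit 0) (.add (.reg 2) (.reg 5)) (.get 1 (.reg 5) (.reg 3)))

lemma leafProg_exec (m : Mem) (t : ℕ) : (leafProg.exec m).arr 3 0 t =
    if m.reg 2 ≤ t ∧ t < m.reg 2 + m.reg 0 then m.arr 1 (t - m.reg 2) (m.reg 3)
    else m.arr 3 0 t := by
  have key := loopState_induction (r := 5) (f := (Prog.setArr 3 (.lit 0) (.add (.reg 2) (.reg 5))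
      (.get 1 (.reg 5) (.reg 3))).exec) (m := m)
    (fun k m' => (∀ q, q ≠ 5 → m'.reg q = m.reg q) ∧ (∀ a, a ≠ 3 → m'.arr a = m.arr a) ∧
      ∀ t, m'.arr 3 0 t = if m.reg 2 ≤ t ∧ t < m.reg 2 + k then m.arr 1 (t - m.reg 2) (m.reg 3)
        else m.arr 3 0 t) (m.reg 0)
    (by
      refine ⟨fun _ _ => rfl, fun _ _ => rfl, fun t => ?_⟩
      rw [if_neg]
      omega) (by
      rintro k hk m' ⟨h1, h2, h3⟩
      refine ⟨?_, ?_, ?_⟩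
      · intro q hq
        simp [Prog.exec, hq, h1 q hq]
      · intro a ha
        rw [Prog.exec, Mem.setArr_arr_ne _ ha, Mem.setReg_arr, h2 a ha]
      · intro t
        simp only [Prog.exec, Mem.setArr_arr, IExpr.eval, RExpr.eval, Mem.setReg_reg,
          Mem.setReg_arr, h2 1 (by norm_num), h1 2 (by norm_num), h1 3 (by norm_num), h3]
        norm_num
        by_cases ht : t = m.reg 2 + k
        · rw [if_pos ht, if_pos (by omega), ht, Nat.add_sub_cancel_left]
        · rw [if_neg ht]
          have : (m.reg 2 ≤ t ∧ t < m.reg 2 + k) ↔ (m.reg 2 ≤ t ∧ t < m.reg 2 + (k + 1)) := by omega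
          simp only [this])
  exact key.2.2 t

lemma leafProg_time (m : Mem) : leafProg.time m ≤ 2 + m.reg 0 * 20 := by
  have h := loop_time_le_of_forall (r := 5) (e := .reg 0) (m := m)
    (p := .setArr 3 (.lit 0) (.add (.reg 2) (.reg 5)) (.get 1 (.reg 5) (.reg 3))) 19 (by
      intro m'
      simp only [Prog.time, IExpr.time, RExpr.time]
      norm_num)
  exact h

def leftExpr : RExpr := .get 3 (.lit 0) (.add (.reg 6) (.reg 6))

def rightExpr : RExpr := .get 3 (.lit 0) (.add (.add (.reg 6) (.reg 6)) (.lit 1))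

def normExpr : RExpr := .sqrt (.add (.mul leftExpr leftExpr) (.mul rightExpr rightExpr))

/-- Compute the value and the angle of the inner node `reg 6` of the heap. -/
def nodeProg : Prog :=
  .seq (.ite (.rlt (.lit 0) rightExpr) (.setArr 3 (.lit 0) (.reg 6) normExpr)
      (.ite (.rlt rightExpr (.lit 0)) (.setArr 3 (.lit 0) (.reg 6) (.sub (.lit 0) normExpr))
        (.setArr 3 (.lit 0) (.reg 6) leftExpr)))
    (.setArr 2 (.reg 3) (.reg 6) (.arccos (.div leftExpr (.get 3 (.lit 0) (.reg 6)))))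

/-- The value of an inner node whose children have the values `a` and `b`. -/
noncomputable def nodeValue (a b : ℝ) : ℝ :=
  if 0 < b then √(a * a + b * b) else if b < 0 then 0 - √(a * a + b * b) else a

/-- The arccosine gives an angle with nonnegative sine, so it recovers the pair only if `w` has the
sign of `b`. -/
lemma cos_sin_arccos_div {a b w : ℝ} (hw : w ≠ 0) (h : w ^ 2 = a ^ 2 + b ^ 2) (hb : 0 ≤ b / w) :
    a = Real.cos (Real.arccos (a / w)) * w ∧ b = Real.sin (Real.arccos (a / w)) * w := by
  have hs : (a / w) ^ 2 + (b / w) ^ 2 = 1 := by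
    rw [div_pow, div_pow, ← add_div, ← h, div_self (pow_ne_zero 2 hw)]
  have habs : |a / w| ≤ 1 := by
    rw [← sq_le_one_iff_abs_le_one]
    nlinarith [sq_nonneg (b / w)]
  rw [abs_le] at habs
  rw [Real.cos_arccos habs.1 habs.2, Real.sin_arccos,
    show 1 - (a / w) ^ 2 = (b / w) ^ 2 by linarith, Real.sqrt_sq hb, div_mul_cancel₀ _ hw,
    div_mul_cancel₀ _ hw]
  exact ⟨rfl, rfl⟩

/-- The sign of the node is that of its right child, as the arccosine requires. If `b = 0` the value
is `a` itself, not `|a|`: the angle is then 0 for `a ≠ 0`, and irrelevant for `a = 0`. -/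
lemma nodeValue_spec (a b : ℝ) :
    a = Real.cos (Real.arccos (a / nodeValue a b)) * nodeValue a b ∧
      b = Real.sin (Real.arccos (a / nodeValue a b)) * nodeValue a b ∧
      (b = 0 → nodeValue a b = a) := by
  rw [nodeValue]
  split_ifs with h1 h2
  · have hsq : 0 < a * a + b * b := by nlinarith [mul_self_nonneg a, mul_self_pos.2 h1.ne']
    have hs := Real.sqrt_pos.2 hsq
    have h := cos_sin_arccos_div (a := a) (b := b) hs.ne'
      (by rw [Real.sq_sqrt hsq.le]; ring) (by positivity)
    exact ⟨h.1, h.2, fun h0 => absurd h0 h1.ne'⟩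
  · have hsq : 0 < a * a + b * b := by nlinarith [mul_self_nonneg a, mul_self_pos.2 h2.ne]
    have hs := Real.sqrt_pos.2 hsq
    have h := cos_sin_arccos_div (a := a) (b := b) (w := 0 - √(a * a + b * b)) (by linarith)
      (by rw [zero_sub, neg_sq, Real.sq_sqrt hsq.le]; ring)
      (div_nonneg_of_nonpos h2.le (by linarith))
    exact ⟨h.1, h.2, fun h0 => absurd h0 h2.ne⟩
  · have hb : b = 0 := le_antisymm (not_lt.1 h1) (not_lt.1 h2)
    subst hb
    by_cases ha : a = 0
    · simp [ha]
    · have h := cos_sin_arccos_div (a := a) (b := 0) ha (by ring) (by simp)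
      exact ⟨h.1, h.2, fun _ => rfl⟩

lemma nodeProg_exec_heap (m : Mem) (t : ℕ) : (nodeProg.exec m).arr 3 0 t =
    if t = m.reg 6 then
      nodeValue (m.arr 3 0 (2 * m.reg 6)) (m.arr 3 0 (2 * m.reg 6 + 1))
    else m.arr 3 0 t := by
  rw [nodeProg, Prog.exec, Prog.exec.eq_2, Mem.setArr_arr_ne _ (by norm_num)]
  simp only [Prog.exec, Test.holds, RExpr.eval, IExpr.eval, leftExpr, rightExpr, normExpr,
    ← two_mul, Int.cast_zero, nodeValue]
  split_ifs <;> simp_all [Mem.setArr_arr]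

lemma nodeProg_exec_angle (m : Mem) (h : 1 ≤ m.reg 6) (r c : ℕ) : (nodeProg.exec m).arr 2 r c =
    if r = m.reg 3 ∧ c = m.reg 6 then
      Real.arccos (m.arr 3 0 (2 * m.reg 6) /
        nodeValue (m.arr 3 0 (2 * m.reg 6)) (m.arr 3 0 (2 * m.reg 6 + 1)))
    else m.arr 2 r c := by
  have hh := nodeProg_exec_heap m
  rw [nodeProg, Prog.exec] at hh ⊢
  set p : Prog := (.ite (.rlt (.lit 0) rightExpr) (.setArr 3 (.lit 0) (.reg 6) normExpr)
      (.ite (.rlt rightExpr (.lit 0)) (.setArr 3 (.lit 0) (.reg 6) (.sub (.lit 0) normExpr))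
        (.setArr 3 (.lit 0) (.reg 6) leftExpr))) with hp
  have hreg : ∀ q, (p.exec m).reg q = m.reg q := fun q =>
    Prog.exec_reg _ _ (by simp [hp, Prog.regs])
  have harr : (p.exec m).arr 2 = m.arr 2 := Prog.exec_arr _ _ (by simp [hp, Prog.arrs])
  simp only [Prog.exec.eq_2, Mem.setArr_arr_ne _ (show 3 ≠ 2 by norm_num)] at hh
  simp only [Prog.exec.eq_2, Mem.setArr_arr, RExpr.eval, IExpr.eval, leftExpr, hreg, harr, hh,
    true_and, if_true, ← two_mul]
  rw [if_neg (show ¬ 2 * m.reg 6 = m.reg 6 by omega)]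

lemma nodeProg_time (m : Mem) : nodeProg.time m ≤ 100 := by
  simp only [nodeProg, Prog.time, Test.time, RExpr.time, IExpr.time, leftExpr, rightExpr, normExpr]
  split_ifs <;> norm_num

/-- Compute the values and the angles of all inner nodes of the heap except the root. -/
def heapProg : Prog :=
  .loop 7 (.sub (.reg 2) (.lit 2))
    (.seq (.setReg 6 (.sub (.reg 2) (.add (.reg 7) (.lit 1)))) nodeProg)

/-- The value `W i` of the node `i` and the angle `F i` fit to the values of the children. -/
def NodeFits (W F : ℕ → ℝ) (i : ℕ) : Prop :=
  W (2 * i) = Real.cos (F i) * W i ∧ W (2 * i + 1) = Real.sin (F i) * W i ∧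
    (W (2 * i + 1) = 0 → W i = W (2 * i))

/-- Nodes are visited in the order `N - 1, …, 2`, where `N` is the content of register 2, so the
children `2 * i` and `2 * i + 1` are final when `i` is visited. -/
lemma heapProg_exec (m : Mem) :
    (∀ t, m.reg 2 ≤ t → (heapProg.exec m).arr 3 0 t = m.arr 3 0 t) ∧
    (∀ r, r ≠ m.reg 3 → (heapProg.exec m).arr 2 r = m.arr 2 r) ∧
    ∀ i, 2 ≤ i → i < m.reg 2 →
      NodeFits ((heapProg.exec m).arr 3 0) ((heapProg.exec m).arr 2 (m.reg 3)) i := by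
  have key := loopState_induction (r := 7)
    (f := (Prog.seq (.setReg 6 (.sub (.reg 2) (.add (.reg 7) (.lit 1)))) nodeProg).exec) (m := m)
    (fun k m' => (∀ q, q ≠ 6 → q ≠ 7 → m'.reg q = m.reg q) ∧
      (∀ t, m.reg 2 ≤ t → m'.arr 3 0 t = m.arr 3 0 t) ∧
      (∀ r, r ≠ m.reg 3 → m'.arr 2 r = m.arr 2 r) ∧
      ∀ i, 2 ≤ i → m.reg 2 - k ≤ i → i < m.reg 2 → NodeFits (m'.arr 3 0) (m'.arr 2 (m.reg 3)) i)
    (m.reg 2 - 2)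
    (by
      refine ⟨fun _ _ _ => rfl, fun _ _ => rfl, fun _ _ => rfl, fun i _ _ _ => ?_⟩
      omega) (by
      rintro k hk m' ⟨h1, h2, h3, h4⟩
      rw [Prog.exec, Prog.exec.eq_1]
      simp only [IExpr.eval, Mem.setReg_reg, if_true, h1 2 (by norm_num) (by norm_num)]
      norm_num
      set m1 := (m'.setReg 7 k).setReg 6 (m.reg 2 - (k + 1)) with hm1
      have e6 : m1.reg 6 = m.reg 2 - (k + 1) := by simp [hm1]
      have ereg : ∀ q, q ≠ 6 → q ≠ 7 → m1.reg q = m.reg q := by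
        intro q h6 h7
        simp [hm1, h6, h7, h1 q h6 h7]
      have earr : m1.arr = m'.arr := rfl
      have hheap := nodeProg_exec_heap m1
      have hang := nodeProg_exec_angle m1 (by omega)
      rw [e6, earr] at hheap hang
      rw [ereg 3 (by norm_num) (by norm_num)] at hang
      refine ⟨?_, ?_, ?_, ?_⟩
      · intro q h6 h7
        rw [Prog.exec_reg _ _ (by simp [nodeProg, Prog.regs]), ereg q h6 h7]
      · intro t ht
        rw [hheap, if_neg (by omega), h2 t ht]
      · intro r hr
        funext c
        rw [hang, if_neg (by simp [hr]), h3 r hr]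
      · intro i hi hki hiN
        simp only [NodeFits, hheap, hang, true_and]
        by_cases hik : i = m.reg 2 - (k + 1)
        · rw [if_pos hik, if_pos hik, if_neg (by omega), if_neg (by omega), ← hik]
          have := nodeValue_spec (m'.arr 3 0 (2 * i)) (m'.arr 3 0 (2 * i + 1))
          exact this
        · rw [if_neg hik, if_neg hik, if_neg (by omega), if_neg (by omega)]
          exact h4 i hi (by omega) hiN)
  refine ⟨key.2.1, key.2.2.1, fun i h2 hN => key.2.2.2 i h2 (by omega) hN⟩

lemma heapProg_time (m : Mem) : heapProg.time m ≤ 4 + m.reg 2 * 107 := by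
  have h := loop_time_le_of_forall (r := 7) (e := .sub (.reg 2) (.lit 2)) (m := m)
    (p := .seq (.setReg 6 (.sub (.reg 2) (.add (.reg 7) (.lit 1)))) nodeProg) 106 (by
      intro m'
      rw [Prog.time, Prog.time.eq_1]
      have := nodeProg_time ((Prog.setReg 6 (.sub (.reg 2) (.add (.reg 7) (.lit 1)))).exec m')
      simp only [IExpr.time]
      omega)
  refine h.trans ?_
  simp only [IExpr.time, IExpr.eval]
  have : (m.reg 2 - 2) * (106 + 1) ≤ m.reg 2 * 107 := Nat.mul_le_mul_right _ (Nat.sub_le _ _)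
  omega

/-- Compute the angle of the root. -/
def rootProg : Prog :=
  .ite (.rlt (.get 3 (.lit 0) (.lit 3)) (.lit 0))
    (.setArr 2 (.reg 3) (.lit 1) (.sub (.lit 0) (.arccos (.get 3 (.lit 0) (.lit 2)))))
    (.setArr 2 (.reg 3) (.lit 1) (.arccos (.get 3 (.lit 0) (.lit 2))))

/-- The root must have value 1, so its sign cannot follow its right child; the sign of the angle
does so instead. -/
lemma rootProg_exec (m : Mem) (r c : ℕ) : (rootProg.exec m).arr 2 r c =
    if r = m.reg 3 ∧ c = 1 then
      if m.arr 3 0 3 < 0 then -Real.arccos (m.arr 3 0 2) else Real.arccos (m.arr 3 0 2)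
    else m.arr 2 r c := by
  rw [rootProg, Prog.exec]
  simp only [Test.holds, RExpr.eval, IExpr.eval, Int.cast_zero]
  split_ifs <;> simp_all [Prog.exec, Mem.setArr_arr, IExpr.eval, RExpr.eval]

lemma rootProg_time (m : Mem) : rootProg.time m ≤ 30 := by
  simp only [rootProg, Prog.time, Test.time, RExpr.time, IExpr.time]
  split_ifs <;> norm_num

/-- The angles `F` come from a heap with `N` leaves that hold the entries of `x`. -/
def AnglesFor (n N : ℕ) (x F : ℕ → ℝ) : Prop :=
  ∃ W : ℕ → ℝ, (∀ p < n, W (N + p) = x p) ∧ (∀ p, n ≤ p → W (N + p) = 0) ∧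
    (∀ i, 2 ≤ i → i < N → NodeFits W F i) ∧
    F 1 = if W 3 < 0 then -Real.arccos (W 2) else Real.arccos (W 2)

lemma NodeFits.sq {W F : ℕ → ℝ} {i : ℕ} (h : NodeFits W F i) :
    W (2 * i) ^ 2 + W (2 * i + 1) ^ 2 = W i ^ 2 := by
  rw [h.1, h.2.1, mul_pow, mul_pow, ← add_mul, Real.cos_sq_add_sin_sq, one_mul]

lemma sum_range_two_mul (f : ℕ → ℝ) (k : ℕ) :
    ∑ q ∈ Finset.range (2 * k), f q = ∑ q ∈ Finset.range k, (f (2 * q) + f (2 * q + 1)) := by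
  induction k with
  | zero => simp
  | succ k ih => rw [Nat.mul_succ, Finset.sum_range_succ, Finset.sum_range_succ, ih,
      Finset.sum_range_succ]; ring

/-- Every level below the root has the same sum of squares, and at the leaves it is the squared norm
of `x`. So the two children of the root form a unit vector, and the angle of the root reproduces it.
-/
lemma AnglesFor.heapEncodes {n K : ℕ} {x F : ℕ → ℝ} (h : AnglesFor n (2 ^ K) x F) (hK : 1 ≤ K)
    (hn : n ≤ 2 ^ K) (hx : ∑ p ∈ Finset.range n, x p ^ 2 = 1) :
    ∃ W, HeapEncodes n K x W F := by
  obtain ⟨W, h1, h2, h3, h4⟩ := h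
  have hN : 2 ≤ 2 ^ K := by
    calc 2 = 2 ^ 1 := rfl
      _ ≤ 2 ^ K := Nat.pow_le_pow_right (by norm_num) hK
  have hlevel : ∀ k, 1 ≤ k → k ≤ K →
      ∑ q ∈ Finset.range (2 ^ k), W (2 ^ k + q) ^ 2 = W 2 ^ 2 + W 3 ^ 2 := by
    intro k hk
    induction k, hk using Nat.le_induction with
    | base => intro _; norm_num [Finset.sum_range_succ]
    | succ k hk ih =>
      intro hkK
      rw [← ih (by omega), pow_succ', sum_range_two_mul]
      refine Finset.sum_congr rfl fun q hq => ?_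
      have hq' := Finset.mem_range.1 hq
      have hlt : 2 ^ (k + 1) ≤ 2 ^ K := Nat.pow_le_pow_right (by norm_num) hkK
      have h2k : 2 ≤ 2 ^ k := by
        calc 2 = 2 ^ 1 := rfl
          _ ≤ 2 ^ k := Nat.pow_le_pow_right (by norm_num) hk
      rw [pow_succ'] at hlt
      have := (h3 (2 ^ k + q) (by omega) (by omega)).sq
      rw [← this]
      congr 3 <;> ring
  have hsum : W 2 ^ 2 + W 3 ^ 2 = 1 := by
    rw [← hlevel K hK le_rfl, ← hx, ← Finset.sum_subset (Finset.range_mono hn)]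
    · exact Finset.sum_congr rfl fun p hp => by rw [h1 p (Finset.mem_range.1 hp)]
    · intro p _ hp
      rw [h2 p (by simpa using hp)]
      ring
  have habs : |W 2| ≤ 1 := by
    rw [← sq_le_one_iff_abs_le_one]
    nlinarith [sq_nonneg (W 3)]
  rw [abs_le] at habs
  have hroot : Real.cos (F 1) = W 2 ∧ Real.sin (F 1) = W 3 := by
    have e : 1 - W 2 ^ 2 = W 3 ^ 2 := by linarith
    rw [h4]
    split_ifs with h
    · rw [Real.cos_neg, Real.sin_neg, Real.cos_arccos habs.1 habs.2, Real.sin_arccos, e,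
        Real.sqrt_sq_eq_abs, abs_of_neg h, neg_neg]
      exact ⟨rfl, rfl⟩
    · rw [Real.cos_arccos habs.1 habs.2, Real.sin_arccos, e, Real.sqrt_sq (not_lt.1 h)]
      exact ⟨rfl, rfl⟩
  have hW : ∀ i, 2 ≤ i → Function.update W 1 1 i = W i := fun i hi => by
    rw [Function.update_of_ne (by omega)]
  -- `AnglesFor` does not constrain `W 1`, so the value 1 of the root is put in here.
  refine ⟨Function.update W 1 1, ?_, ?_, ?_, ?_, ?_, ?_⟩
  · simp
  · intro p hp
    rw [hW _ (by omega), h1 p hp]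
  · intro p hp _
    rw [hW _ (by omega), h2 p hp]
  · intro i hi hiK
    rw [hW (2 * i) (by omega)]
    rcases Nat.lt_or_ge i 2 with h | h
    · obtain rfl : i = 1 := by omega
      simp [hroot.1]
    · rw [hW i h, (h3 i h hiK).1]
  · intro i hi hiK
    rw [hW (2 * i + 1) (by omega)]
    rcases Nat.lt_or_ge i 2 with h | h
    · obtain rfl : i = 1 := by omega
      simp [hroot.2]
    · rw [hW i h, (h3 i h hiK).2.1]
  · intro i hi hiK
    rw [hW _ hi, hW (2 * i) (by omega), hW (2 * i + 1) (by omega)]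
    exact (h3 i hi hiK).2.2

/-- Compute the angles for the current column. -/
def anglesProg : Prog := .seq leafProg (.seq heapProg rootProg)

lemma anglesProg_time (m : Mem) : anglesProg.time m ≤ 36 + m.reg 0 * 20 + m.reg 2 * 107 := by
  rw [anglesProg, Prog.time, Prog.time]
  have h1 := leafProg_time m
  have h2 := heapProg_time (leafProg.exec m)
  rw [Prog.exec_reg _ _ (by simp [leafProg, Prog.regs])] at h2
  have h3 := rootProg_time (heapProg.exec (leafProg.exec m))
  omega

/-- The heap array is reused for all columns. Used leaves and inner nodes are overwritten each time,
while the unused leaves are never written and keep their initial value 0; hence this condition is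
assumed and returned. -/
lemma anglesProg_exec (m : Mem)
    (h0 : ∀ t, m.reg 2 + m.reg 0 ≤ t → m.arr 3 0 t = 0) :
    (∀ t, m.reg 2 + m.reg 0 ≤ t → (anglesProg.exec m).arr 3 0 t = 0) ∧
    (∀ r, r ≠ m.reg 3 → (anglesProg.exec m).arr 2 r = m.arr 2 r) ∧
    AnglesFor (m.reg 0) (m.reg 2) (fun p => m.arr 1 p (m.reg 3))
      ((anglesProg.exec m).arr 2 (m.reg 3)) := by
  rw [anglesProg, Prog.exec, Prog.exec]
  have hl := leafProg_exec m
  set m1 := leafProg.exec m with hm1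
  have r1 : ∀ q, q ≠ 5 → m1.reg q = m.reg q := fun q hq =>
    Prog.exec_reg _ _ (by simpa [leafProg, Prog.regs] using hq)
  have a1 : m1.arr 2 = m.arr 2 := Prog.exec_arr _ _ (by simp [leafProg, Prog.arrs])
  obtain ⟨k1, k2, k3⟩ := heapProg_exec m1
  rw [r1 2 (by norm_num)] at k1 k3
  rw [r1 3 (by norm_num)] at k2 k3
  set m2 := heapProg.exec m1 with hm2
  have r2 : m2.reg 3 = m.reg 3 := by
    rw [hm2, Prog.exec_reg _ _ (by simp [heapProg, nodeProg, Prog.regs]), r1 3 (by norm_num)]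
  have hr := rootProg_exec m2
  rw [r2] at hr
  have a3 : (rootProg.exec m2).arr 3 = m2.arr 3 := Prog.exec_arr _ _ (by simp [rootProg, Prog.arrs])
  refine ⟨?_, ?_, m2.arr 3 0, ?_, ?_, ?_, ?_⟩
  · intro t ht
    rw [a3, k1 t (by omega), hl, if_neg (by omega), h0 t ht]
  · intro r hrr
    funext c
    rw [hr, if_neg (by simp [hrr]), k2 r hrr, a1]
  · intro p hp
    rw [k1 _ (by omega), hl, if_pos (by omega), Nat.add_sub_cancel_left]
  · intro p hp
    rw [k1 _ (by omega), hl, if_neg (by omega), h0 _ (by omega)]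
  · intro i hi hiN
    have := k3 i hi hiN
    simp only [NodeFits, hr] at this ⊢
    rwa [if_neg (by omega)]
  · rw [hr, if_pos ⟨rfl, rfl⟩]

/-! ### The complete program -/

/-- Orthogonalize the current column and compute its angles. -/
def columnProg : Prog := .seq gramSchmidtProg anglesProg

/-- The classical pre-processing. -/
def preprocess : Prog := .seq heapSizeProg (.loop 3 (.reg 1) columnProg)

lemma columnProg_time (m : Mem) : columnProg.time m ≤
    56 + m.reg 0 * 70 + m.reg 2 * 107 + m.reg 3 * (9 + m.reg 0 * 32) := by
  rw [columnProg, Prog.time]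
  have h1 := gramSchmidtProg_time m
  have h2 := anglesProg_time (gramSchmidtProg.exec m)
  rw [Prog.exec_reg _ _ (by simp [gramSchmidtProg, projProg, colProg, sumProg, Prog.regs]),
    Prog.exec_reg _ _ (by simp [gramSchmidtProg, projProg, colProg, sumProg, Prog.regs])] at h2
  omega

/-- Column `c` of `q` is the result of a step of the Gram–Schmidt process. -/
def IsGramSchmidtCol (n : ℕ) (a q : ℕ → ℕ → ℝ) (c : ℕ) : Prop :=
  ∀ r < n, q r c = residual n a q c r / √(∑ k ∈ Finset.range n, residual n a q c k ^ 2)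

lemma residual_congr {n : ℕ} {a q q' : ℕ → ℕ → ℝ} {c : ℕ} (h : ∀ r < n, ∀ i < c, q r i = q' r i)
    {r : ℕ} (hr : r < n) : residual n a q c r = residual n a q' c r := by
  rw [residual, residual]
  congr 1
  refine Finset.sum_congr rfl fun i hi => ?_
  have hi' := Finset.mem_range.1 hi
  rw [h r hr i hi', Finset.sum_congr rfl fun k hk => by rw [h k (Finset.mem_range.1 hk) i hi']]

/-- The condition involves only the columns up to `c`, so it survives the writing of later columns.
-/
lemma IsGramSchmidtCol.congr {n : ℕ} {a q q' : ℕ → ℕ → ℝ} {c : ℕ} (hq : IsGramSchmidtCol n a q c)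
    (h : ∀ r < n, ∀ i ≤ c, q r i = q' r i) : IsGramSchmidtCol n a q' c := by
  intro r hr
  have h' : ∀ r < n, ∀ i < c, q r i = q' r i := fun r hr i hi => h r hr i hi.le
  rw [← h r hr c le_rfl, hq r hr, residual_congr h' hr, Finset.sum_congr rfl fun k hk => by
    rw [residual_congr h' (Finset.mem_range.1 hk)]]

lemma AnglesFor.congr {n N : ℕ} {x y F : ℕ → ℝ} (h : AnglesFor n N x F) (hxy : ∀ p < n, x p = y p) :
    AnglesFor n N y F := by
  obtain ⟨W, h1, h2⟩ := h
  exact ⟨W, fun p hp => (h1 p hp).trans (hxy p hp), h2⟩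

/-- The state of the main loop after `j` rounds. -/
structure LoopInv (n N : ℕ) (a : ℕ → ℕ → ℝ) (j : ℕ) (m : Mem) : Prop where
  reg0 : m.reg 0 = n
  reg2 : m.reg 2 = N
  input : m.arr 0 = a
  heap : ∀ t, N + n ≤ t → m.arr 3 0 t = 0
  cols : ∀ c < j, IsGramSchmidtCol n a (m.arr 1) c
  angles : ∀ c < j, AnglesFor n N (fun p => m.arr 1 p c) (m.arr 2 c)

lemma LoopInv.step {n N : ℕ} {a : ℕ → ℕ → ℝ} {j : ℕ} {m : Mem}
    (h : LoopInv n N a j m) : LoopInv n N a (j + 1) (columnProg.exec (m.setReg 3 j)) := by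
  rw [columnProg, Prog.exec]
  have hg := gramSchmidtProg_exec (m.setReg 3 j)
  simp only [Mem.setReg_reg, Mem.setReg_arr, if_true] at hg
  norm_num at hg
  rw [h.reg0, h.input] at hg
  set m1 := gramSchmidtProg.exec (m.setReg 3 j) with hm1
  have r1 : ∀ q, q ≠ 4 → q ≠ 5 → m1.reg q = (m.setReg 3 j).reg q := fun q h4 h5 =>
    Prog.exec_reg _ _ (by
      simp [gramSchmidtProg, projProg, colProg, sumProg, Prog.regs, h4, h5])
  have a1 : ∀ b, b ≠ 1 → b ≠ 4 → m1.arr b = m.arr b := fun b h1 h4 =>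
    Prog.exec_arr _ _ (by
      simp [gramSchmidtProg, projProg, colProg, sumProg, Prog.arrs, h1, h4])
  have r0 : m1.reg 0 = n := by rw [r1 0 (by norm_num) (by norm_num)]; simp [h.reg0]
  have r2 : m1.reg 2 = N := by rw [r1 2 (by norm_num) (by norm_num)]; simp [h.reg2]
  have r3 : m1.reg 3 = j := by rw [r1 3 (by norm_num) (by norm_num)]; simp
  have ha := anglesProg_exec m1 (by
    rw [r0, r2, a1 3 (by norm_num) (by norm_num)]
    exact h.heap)
  rw [r0, r2, r3] at ha
  obtain ⟨k1, k2, k3⟩ := ha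
  set m2 := anglesProg.exec m1 with hm2
  have regs2 : ∀ q, q ≠ 5 → q ≠ 6 → q ≠ 7 → m2.reg q = m1.reg q := fun q h5 h6 h7 =>
    Prog.exec_reg _ _ (by
      simp [anglesProg, leafProg, heapProg, nodeProg, rootProg, Prog.regs, h5, h6, h7])
  have arrs2 : ∀ b, b ≠ 2 → b ≠ 3 → m2.arr b = m1.arr b := fun b h2 h3 =>
    Prog.exec_arr _ _ (by
      simp [anglesProg, leafProg, heapProg, nodeProg, rootProg, Prog.arrs, h2, h3])
  have q2 : m2.arr 1 = m1.arr 1 := arrs2 1 (by norm_num) (by norm_num)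
  have hold : ∀ r c, c < j → m.arr 1 r c = m1.arr 1 r c := by
    intro r c hc
    rw [hg, if_neg (by omega)]
  refine ⟨?_, ?_, ?_, k1, ?_, ?_⟩
  · rw [regs2 0 (by norm_num) (by norm_num) (by norm_num), r0]
  · rw [regs2 2 (by norm_num) (by norm_num) (by norm_num), r2]
  · rw [arrs2 0 (by norm_num) (by norm_num), a1 0 (by norm_num) (by norm_num), h.input]
  · intro c hc
    rw [q2]
    rcases Nat.lt_succ_iff_lt_or_eq.1 hc with hc | rfl
    · exact (h.cols c hc).congr fun r _ i hi => hold r i (by omega)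
    · intro r hr
      have h' : ∀ r < n, ∀ i < c, m.arr 1 r i = m1.arr 1 r i := fun r _ i hi => hold r i hi
      rw [hg, if_pos ⟨rfl, hr⟩, residual_congr h' hr, Finset.sum_congr rfl fun k hk => by
        rw [residual_congr h' (Finset.mem_range.1 hk)]]
  · intro c hc
    rcases Nat.lt_succ_iff_lt_or_eq.1 hc with hc | rfl
    · rw [q2, k2 c hc.ne, a1 2 (by norm_num) (by norm_num)]
      exact (h.angles c hc).congr fun p _ => hold p c hc
    · rw [q2]
      exact k3

/-- Rounding up to a power of two at most doubles, so the pass over the heap stays linear in `n`. -/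
lemma two_pow_clog_le {n : ℕ} (hn : 2 ≤ n) : 2 ^ Nat.clog 2 n ≤ 2 * n := by
  have h := Nat.pow_pred_clog_lt_self (b := 2) (by norm_num) (x := n) (by omega)
  have hpos : 0 < Nat.clog 2 n := Nat.clog_pos (by norm_num) hn
  calc 2 ^ Nat.clog 2 n = 2 * 2 ^ (Nat.clog 2 n - 1) := by rw [← pow_succ']; congr 1; omega
    _ ≤ 2 * n := by
      have : 2 ^ (Nat.clog 2 n - 1) < n := h
      omega

lemma preprocess_spec {n d : ℕ} (A : Matrix (Fin n) (Fin d) ℝ) (hn : 2 ≤ n) (hd : 1 ≤ d) :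
    preprocess.time (inputMem A) ≤ 1000 * (n * d ^ 2) ∧
      LoopInv n (2 ^ Nat.clog 2 n) ((inputMem A).arr 0) d (preprocess.exec (inputMem A)) := by
  have i0 : (inputMem A).reg 0 = n := by simp [inputMem]
  have i1 : (inputMem A).reg 1 = d := by simp [inputMem]
  have ht := heapSizeProg_time (inputMem A)
  have he := heapSizeProg_exec (inputMem A)
  rw [i0] at ht he
  rw [preprocess, Prog.time, Prog.exec]
  set m1 := heapSizeProg.exec (inputMem A) with hm1
  have r1 : ∀ q, q ≠ 2 → q ≠ 7 → m1.reg q = (inputMem A).reg q := fun q h2 h7 =>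
    Prog.exec_reg _ _ (by simp [heapSizeProg, Prog.regs, h2, h7])
  have a1 : ∀ b, m1.arr b = (inputMem A).arr b := fun b =>
    Prog.exec_arr _ _ (by simp [heapSizeProg, Prog.arrs])
  have hN' := two_pow_clog_le hn
  have ee : (IExpr.reg 1).eval m1 = d := by
    simp [IExpr.eval, r1, i1]
  -- The bound for one round is `columnProg_time` with heap size at most `2 * n` and column index at
  -- most `d`.
  have h := loop_time_le (r := 3) (e := .reg 1) (p := columnProg) (m := m1)
    (LoopInv n (2 ^ Nat.clog 2 n) ((inputMem A).arr 0))
    (56 + n * 70 + (2 * n) * 107 + d * (9 + n * 32))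
    ⟨by rw [r1 0 (by norm_num) (by norm_num), i0], he, a1 0, fun t _ => by
      rw [a1]; simp [inputMem], fun c hc => absurd hc (by omega), fun c hc => absurd hc (by omega)⟩
    (by
      intro k hk m' hm'
      rw [ee] at hk
      refine ⟨(columnProg_time _).trans ?_, hm'.step⟩
      simp only [Mem.setReg_reg]
      norm_num
      rw [hm'.reg0, hm'.reg2]
      gcongr)
  rw [ee] at h
  refine ⟨?_, h.2⟩
  have h1 := h.1
  simp only [IExpr.time] at h1
  refine (add_le_add ht h1).trans ?_
  have hd2 : d ≤ d ^ 2 := Nat.le_self_pow two_ne_zero d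
  have e1 : n ≤ n * d ^ 2 := Nat.le_mul_of_pos_right _ (by positivity)
  have e2 : d ≤ n * d ^ 2 := hd2.trans (Nat.le_mul_of_pos_left _ (by omega))
  have e3 : n * d ≤ n * d ^ 2 := Nat.mul_le_mul_left _ hd2
  have e4 : d ^ 2 ≤ n * d ^ 2 := Nat.le_mul_of_pos_left _ (by omega)
  have e5 : 1 ≤ n * d ^ 2 := by omega
  nlinarith

/-! ## Correctness of the Gram–Schmidt process -/

/-- The second claim, a triangular expression of the new columns by the old ones, is what drives the
induction: it shows that the next residual is a combination of the columns of `a` with coefficient 1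
at column `j`, hence nonzero by independence. -/
lemma gramSchmidt_orthonormal {n d : ℕ} {a q : ℕ → ℕ → ℝ}
    (hinj : ∀ y : ℕ → ℝ, (∀ r < n, ∑ i ∈ Finset.range d, a r i * y i = 0) → ∀ i < d, y i = 0)
    (hq : ∀ c < d, IsGramSchmidtCol n a q c) (j : ℕ) : j ≤ d →
    (∀ c < j, ∀ c' < j, ∑ r ∈ Finset.range n, q r c * q r c' = if c = c' then 1 else 0) ∧
    ∃ y : ℕ → ℕ → ℝ, ∀ c < j, (∀ r < n, q r c = ∑ i ∈ Finset.range d, a r i * y c i) ∧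
      ∀ i, c < i → y c i = 0 := by
  induction j with
  | zero => exact fun _ => ⟨fun c hc => absurd hc (by omega), 0, fun c hc => absurd hc (by omega)⟩
  | succ j ih =>
    intro hj
    obtain ⟨horth, y, hy⟩ := ih (by omega)
    set v := residual n a q j with hv
    set coef : ℕ → ℝ := fun i => ∑ k ∈ Finset.range n, q k i * a k j with hcoef
    -- The coordinates of the residual in the columns of `a`; triangularity of `y` makes `z j = 1`.
    set z : ℕ → ℝ := fun i => (if i = j then 1 else 0) - ∑ i' ∈ Finset.range j, coef i' * y i' i
      with hz
    have hvr : ∀ r, v r = a r j - ∑ i ∈ Finset.range j, coef i * q r i := fun r => rfl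
    have hzgt : ∀ i, j ≤ i → ∑ i' ∈ Finset.range j, coef i' * y i' i = 0 := fun i hi =>
      Finset.sum_eq_zero fun i' hi' => by
        have hlt := Finset.mem_range.1 hi'
        rw [(hy i' hlt).2 i (by omega), mul_zero]
    have hvz : ∀ r < n, v r = ∑ i ∈ Finset.range d, a r i * z i := by
      intro r hr
      have e1 : ∑ i ∈ Finset.range d, a r i * (if i = j then 1 else 0) = a r j := by
        simp; omega
      simp only [hz, mul_sub, Finset.sum_sub_distrib, e1, Finset.mul_sum]
      rw [hvr, Finset.sum_comm]
      congr 1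
      refine Finset.sum_congr rfl fun i' hi' => ?_
      rw [(hy i' (Finset.mem_range.1 hi')).1 r hr, Finset.mul_sum]
      exact Finset.sum_congr rfl fun i _ => by ring
    set S := ∑ k ∈ Finset.range n, v k ^ 2 with hS
    have hSpos : 0 < S := by
      refine lt_of_le_of_ne (Finset.sum_nonneg fun k _ => sq_nonneg _) fun h0 => ?_
      have h1 : ∀ r < n, v r = 0 := fun r hr => by
        have := (Finset.sum_eq_zero_iff_of_nonneg fun k _ => sq_nonneg (v k)).1 h0.symm r
          (Finset.mem_range.2 hr)
        exact pow_eq_zero_iff two_ne_zero |>.1 this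
      have h2 := hinj z (fun r hr => by rw [← hvz r hr, h1 r hr]) j (by omega)
      simp only [hz, hzgt j le_rfl] at h2
      simp at h2
    have hqj : ∀ r < n, q r j = v r / √S := hq j (by omega)
    have hvc : ∀ c < j, ∑ r ∈ Finset.range n, q r c * q r j = 0 := by
      intro c hc
      have e1 : ∀ r ∈ Finset.range n, q r c * q r j = (q r c * a r j -
          ∑ i ∈ Finset.range j, coef i * (q r c * q r i)) / √S := by
        intro r hr
        rw [hqj r (Finset.mem_range.1 hr), hvr, mul_div_assoc', mul_sub, Finset.mul_sum]
        congr 2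
        exact Finset.sum_congr rfl fun i _ => by ring
      rw [Finset.sum_congr rfl e1, ← Finset.sum_div, Finset.sum_sub_distrib, Finset.sum_comm]
      simp only [← Finset.mul_sum]
      rw [Finset.sum_congr (s₁ := Finset.range j) rfl fun i hi => by
        rw [horth c hc i (Finset.mem_range.1 hi)]]
      have : ∑ i ∈ Finset.range j, coef i * (if c = i then 1 else 0) = coef c := by
        simp; omega
      rw [this, hcoef, sub_self, zero_div]
    have hnorm : ∑ r ∈ Finset.range n, q r j * q r j = 1 := by
      have e1 : ∀ r ∈ Finset.range n, q r j * q r j = v r ^ 2 / S := by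
        intro r hr
        rw [hqj r (Finset.mem_range.1 hr), div_mul_div_comm, Real.mul_self_sqrt hSpos.le, sq]
      rw [Finset.sum_congr rfl e1, ← Finset.sum_div, ← hS, div_self hSpos.ne']
    refine ⟨?_, Function.update y j (fun i => z i / √S), ?_⟩
    · intro c hc c' hc'
      rcases Nat.lt_succ_iff_lt_or_eq.1 hc with hc | rfl
      · rcases Nat.lt_succ_iff_lt_or_eq.1 hc' with hc' | rfl
        · exact horth c hc c' hc'
        · rw [if_neg hc.ne]
          exact hvc c hc
      · rcases Nat.lt_succ_iff_lt_or_eq.1 hc' with hc' | rfl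
        · rw [if_neg hc'.ne']
          simpa only [mul_comm] using hvc c' hc'
        · rw [if_pos rfl]
          exact hnorm
    · intro c hc
      rcases Nat.lt_succ_iff_lt_or_eq.1 hc with hc | rfl
      · rw [Function.update_of_ne hc.ne]
        exact hy c hc
      · rw [Function.update_self]
        refine ⟨fun r hr => ?_, fun i hi => ?_⟩
        · rw [hqj r hr, hvz r hr, Finset.sum_div]
          exact Finset.sum_congr rfl fun i _ => by ring
        · simp only [hz, hzgt i hi.le, if_neg hi.ne']
          simp

lemma rank_eq_of_transpose_mul_self {n d : ℕ} {Q : Matrix (Fin n) (Fin d) ℝ} (hQ : Qᵀ * Q = 1) :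
    Q.rank = d := by
  rw [← Matrix.rank_transpose_mul_self, hQ, Matrix.rank_one, Fintype.card_fin]

/-- The triangular expression gives one inclusion of column spaces; equal ranks turn it into
equality. -/
lemma outputMatrix_spec {n d : ℕ} {A : Matrix (Fin n) (Fin d) ℝ} (hA : A.rank = d) {m : Mem}
    (hq : ∀ c < d, IsGramSchmidtCol n ((inputMem A).arr 0) (m.arr 1) c) :
    (outputMatrix n d m)ᵀ * outputMatrix n d m = 1 ∧
      LinearMap.range (outputMatrix n d m).mulVecLin = LinearMap.range A.mulVecLin := by
  set a := (inputMem A).arr 0 with ha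
  have haA : ∀ (r : Fin n) (c : Fin d), a r c = A r c := by
    intro r c
    simp [ha, inputMem]
  have hinj : ∀ y : ℕ → ℝ, (∀ r < n, ∑ i ∈ Finset.range d, a r i * y i = 0) →
      ∀ i < d, y i = 0 := by
    intro y hy i hi
    have h0 : A *ᵥ (fun i : Fin d => y i) = 0 := by
      funext r
      have := hy r r.2
      rw [Finset.sum_range] at this
      simpa [Matrix.mulVec, dotProduct, haA] using this
    exact congrFun (eq_zero_of_mulVec_eq_zero_of_rank hA h0) ⟨i, hi⟩
  obtain ⟨horth, y, hy⟩ := gramSchmidt_orthonormal hinj hq d le_rfl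
  have hQ : (outputMatrix n d m)ᵀ * outputMatrix n d m = 1 := by
    ext c c'
    have := horth c c.2 c' c'.2
    rw [Finset.sum_range] at this
    rw [Matrix.mul_apply, Matrix.one_apply]
    simpa [outputMatrix, Fin.ext_iff] using this
  have hfac : outputMatrix n d m = A * Matrix.of fun i c : Fin d => y c i := by
    ext r c
    rw [Matrix.mul_apply]
    have := (hy c c.2).1 r r.2
    rw [Finset.sum_range] at this
    simpa [outputMatrix, haA] using this
  refine ⟨hQ, Submodule.eq_of_le_of_finrank_eq ?_ ?_⟩
  · rw [hfac, Matrix.mulVecLin_mul]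
    exact LinearMap.range_comp_le_range _ _
  · exact (rank_eq_of_transpose_mul_self hQ).trans hA.symm

/-! ## The main theorem -/

/-- From `2 ^ Nat.clog 2 n ≤ 2 * n ≤ n ^ 2` and 2 / log 2 < 3. -/
lemma clog_le_log {n : ℕ} (hn : 2 ≤ n) : (Nat.clog 2 n : ℝ) ≤ 3 * Real.log n := by
  have h : (2 : ℝ) ^ Nat.clog 2 n ≤ (n : ℝ) ^ 2 := by
    have h1 := two_pow_clog_le hn
    have h2 : 2 * n ≤ n ^ 2 := by nlinarith
    exact_mod_cast h1.trans h2
  have h3 := Real.log_le_log (by positivity) h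
  rw [Real.log_pow, Real.log_pow] at h3
  have h4 := Real.log_two_gt_d9
  have h5 : (0 : ℝ) ≤ Nat.clog 2 n := Nat.cast_nonneg _
  push_cast at h3
  nlinarith

lemma one_le_two_mul_log {n : ℕ} (hn : 2 ≤ n) : 1 ≤ 2 * Real.log n := by
  have h1 : Real.log 2 ≤ Real.log n := Real.log_le_log (by norm_num) (by exact_mod_cast hn)
  have h4 := Real.log_two_gt_d9
  linarith

lemma depth_flatMap_le {n : ℕ} {ι : Type} (l : List ι) (c : ι → Circuit n ℝ) (b : ℕ)
    (h : ∀ j, (c j).depth ≤ b) : Circuit.depth (l.flatMap c) ≤ l.length * b := by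
  induction l with
  | nil => simp [Circuit.depth]
  | cons j l ih =>
    have := h j
    simp only [Circuit.depth, List.flatMap_cons, List.length_append, List.length_cons] at *
    linarith

lemma size_flatMap_le {n : ℕ} {ι : Type} (l : List ι) (c : ι → Circuit n ℝ) (b : ℕ)
    (h : ∀ j, (c j).size ≤ b) : Circuit.size (l.flatMap c) ≤ l.length * b := by
  induction l with
  | nil => simp [Circuit.size]
  | cons j l ih =>
    have := h j
    simp only [Circuit.size, List.flatMap_cons, List.flatten_append, List.length_append,
      List.length_cons] at *
    linarith

end QDS

/-- Quantum determinant sampling. `P` is the classical pre-processing program, and `L n` is the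
layout of a Clifford loader on `n` qubits, in which `P` fills in the angles. -/
theorem mainTheorem1 :
    ∃ (C : ℝ) (P : QDS.Prog) (L : ∀ n : ℕ, QDS.Circuit n ℕ), 0 < C ∧
      ∀ (n d : ℕ) [NeZero n] (A : Matrix (Fin n) (Fin d) ℝ), 2 ≤ n → 1 ≤ d → A.rank = d →
        ∀ (m : QDS.Mem) (Q : Matrix (Fin n) (Fin d) ℝ) (loader : Fin d → QDS.Circuit n ℝ)
          (circuit : QDS.Circuit n ℝ),
          m = P.exec (QDS.inputMem A) →
          Q = QDS.outputMatrix n d m →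
          (∀ j : Fin d, loader j = (L n).fill (QDS.outputAngles m j)) →
          circuit = (List.finRange d).flatMap loader →
          -- the pre-processing takes `O(n d²)` steps and orthogonalizes `A`
          (P.time (QDS.inputMem A) : ℝ) ≤ C * (n * d ^ 2) ∧
          Qᵀ * Q = 1 ∧
          LinearMap.range Q.mulVecLin = LinearMap.range A.mulVecLin ∧
          -- the circuit applies Clifford loaders for the columns of `Q` one after the other
          (∀ j : Fin d, QDS.ImplementsCliffordLoader (loader j) (fun i => Q i j)) ∧
          -- the number of gates and the depth of the circuit
          circuit.IsParallel ∧
          (circuit.size : ℝ) ≤ C * (n * d * Real.log n) ∧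
          (circuit.depth : ℝ) ≤ C * (d * Real.log n) ∧
          -- measuring the circuit's output on `|0ⁿ⟩` gives a sample from the determinant distribution
          ∀ S : Finset (Fin n), circuit.outcomeProb S = QDS.detDist A S := by
  -- The constant is dictated by the running time; for gates and depth 14 = 4 · 3 + 2 is enough.
  refine ⟨1000, QDS.preprocess, QDS.loaderLayout, by norm_num, ?_⟩
  intro n d _ A hn hd hA m Q loader circuit hm hQ hloader hcircuit
  obtain ⟨htime, hinv⟩ := QDS.preprocess_spec A hn hd
  rw [← hm] at hinv
  obtain ⟨hQQ, hrange⟩ := QDS.outputMatrix_spec hA hinv.cols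
  rw [← hQ] at hQQ hrange
  have hlog := QDS.clog_le_log hn
  have hlog1 := QDS.one_le_two_mul_log hn
  have hcol : ∀ j : Fin d, (loader j).op = QDS.jw Finset.univ (fun i => Q i j) ∧
      QDS.ImplementsCliffordLoader (loader j) (fun i => Q i j) := by
    intro j
    have hsum : ∑ p ∈ Finset.range n, m.arr 1 p j ^ 2 = 1 := by
      have := congrFun (congrFun hQQ j) j
      rw [Matrix.mul_apply, Matrix.one_apply_eq] at this
      rw [Finset.sum_range, ← this, hQ]
      exact Finset.sum_congr rfl fun i _ => by simp [QDS.outputMatrix, sq]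
    obtain ⟨W, hW⟩ := (hinv.angles j j.2).heapEncodes (Nat.clog_pos (by norm_num) hn)
      (Nat.le_pow_clog (by norm_num) n) hsum
    rw [hloader j, hQ]
    exact QDS.loaderLayout_fill hn hW
  have hsize : ∀ j, (loader j).size ≤ 4 * n * Nat.clog 2 n + 1 := fun j => by
    rw [hloader j, QDS.fill_size]
    exact QDS.loaderLayout_size n
  have hdepth : ∀ j, (loader j).depth ≤ 4 * Nat.clog 2 n + 1 := fun j => by
    rw [hloader j, QDS.fill_depth]
    exact QDS.loaderLayout_depth n
  refine ⟨by exact_mod_cast htime, hQQ, hrange, fun j => (hcol j).2, ?_, ?_, ?_, ?_⟩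
  · intro l hl
    rw [hcircuit] at hl
    obtain ⟨j, _, hj⟩ := List.mem_flatMap.1 hl
    rw [hloader j] at hj
    exact QDS.fill_isParallel (QDS.loaderLayout_isParallel n) _ l hj
  · have h := QDS.size_flatMap_le (List.finRange d) loader _ hsize
    rw [← hcircuit, List.length_finRange] at h
    have h' : (circuit.size : ℝ) ≤ d * (4 * n * Nat.clog 2 n + 1) := by exact_mod_cast h
    have hn1 : (1 : ℝ) ≤ n := by exact_mod_cast (by omega : 1 ≤ n)
    calc (circuit.size : ℝ) ≤ d * (4 * n * Nat.clog 2 n + 1) := h'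
      _ ≤ d * (4 * n * (3 * Real.log n) + n * (2 * Real.log n)) := by
        gcongr
        nlinarith
      _ = 14 * (n * d * Real.log n) := by ring
      _ ≤ 1000 * (n * d * Real.log n) := by
        gcongr
        norm_num
  · have h := QDS.depth_flatMap_le (List.finRange d) loader _ hdepth
    rw [← hcircuit, List.length_finRange] at h
    have h' : (circuit.depth : ℝ) ≤ d * (4 * Nat.clog 2 n + 1) := by exact_mod_cast h
    calc (circuit.depth : ℝ) ≤ d * (4 * Nat.clog 2 n + 1) := h'
      _ ≤ d * (4 * (3 * Real.log n) + 2 * Real.log n) := by gcongr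
      _ = 14 * (d * Real.log n) := by ring
      _ ≤ 1000 * (d * Real.log n) := by
        gcongr
        norm_num
  · intro S
    obtain ⟨s, hs, hstate⟩ := QDS.seqOp_jw_mulVec d Q hQQ
    rw [← QDS.detOn_sq_eq_detDist A Q hQQ hA hrange.ge S, QDS.Circuit.outcomeProb, hcircuit,
      QDS.op_flatMap, List.map_congr_left fun j _ => (hcol j).1, hstate]
    simp only [QDS.onesOf_bitsOf]
    rw [Complex.norm_real, Real.norm_eq_abs, sq_abs, mul_pow, hs, one_mul]
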